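/- Let $U\subset\mathbb{R}^p$ be nonempty and compact, let $f,g:U\times\mathbb{R}^m\to\mathbb{R}^m$ and $r:U\times\mathbb{R}^m\to\mathbb{R}$ be continuous and Lipschitz in $y$ uniformly in $u\in U$, and let $Y\subset\mathbb{R}^m$ and $Z\subset\mathbb{R}^k$ be compact. Let $F:\mathbb{R}^m\to\mathbb{R}^k$ be differentiable with Lipschitz derivative in a neighbourhood of $Y$, with $F'(y)f(u,y)=0$ for all $u\in U$, $y\in Y$. Put $Y_z=\{y\in\mathbb{R}^m: F(y)=z\}$ and assume that $Y_z\subset Y$ for $z\in Z$ and that $d_H(Y_{z'},Y_{z''})\le L_0\|z'-z''\|$ for all $z',z''\in Z$ and some constant $L_0$, where $d_H$ is the Hausdorff distance. Let $\mathcal{P}(X)$ denote the set of Borel probability measures on a compact metric space $X$, let $\rho$ be any metric on $\mathcal{P}(U\times Y)$ consistent with the weak$^*$ topology, and let $\rho_H$ be the Hausdorff (semi)metric defined by $\rho$. The occupational measure on $[0,S]$ of a measurable function $w$ is $Q\mapsto\frac1S\int_0^S 1_Q(w(t))\,dt$. Let $$W(z)=\Big\{\mu\in\mathcal{P}(U\times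 Y):\ \int_{U\times Y_z}\nabla\phi(y)^Tf(u,y)\,\mu(du,dy)=0\ \ \forall\phi\in C^1(\mathbb{R}^m),\ \ \mathrm{supp}(\mu)\subset U\times Y_z\Big\},$$ $$V(z)=\Big\{\Big(\int_{U\times Y} F'(y)g(u,y)\,\mu(du,dy),\ \int_{U\times Y} r(u,y)\,\mu(du,dy)\Big):\ \mu\in W(z)\Big\}\subset\mathbb{R}^{k+1},$$ and let $\mathcal{M}_z(S,y_0)$, for $y_0\in Y_z$, be the set of occupational measures on $[0,S]$ of the pairs $(u(\cdot),y(\cdot))$, where $u(\cdot)$ is a measurable control with values in $U$ and $y(\cdot)$ is the corresponding solution of $y'=f(u,y)$, $y(0)=y_0$. Suppose that $f(u,y)=f(y)$ does not depend on $u$ and that for each $z\in Z$ the system $y'=f(y)$ has a $T_z$-periodic solution $y_z(\cdot)$ ($T_z>0$) contained in $Y_z$, with $T_z$ bounded uniformly in $z\in Z$, such that any other solution with initial condition in $Y_z$ is a time shift of $y_z(\cdot)$. Let $\nu_z$ be the occupational measure of $y_z(\cdot)$ on $[0,T_z]$, that is, $\int q\,d\nu_z=\frac1{T_z}\int_0^{T_z}q(y_z(\tau))\,d\tau$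 for all continuous $q$. Then: (i) For each $z\in Z$, $$W(z)=\{\mu\in\mathcal{P}(U\times Y):\ \mu(du,dy)=\sigma(du|y)\,\nu_z(dy)\ \text{ for some Borel measurable } \sigma(du|\cdot):Y\to\mathcal{P}(U)\}.$$ (ii) There is a function $\beta$ with $\lim_{S\to\infty}\beta(S)=0$ such that for all $S>0$, $z\in Z$ and $y_0\in Y_z$, $$\sup_{\mu\in W(z)}\rho(\mu,\mathcal{M}_z(S,y_0))\le\beta(S).$$ (iii) If, in addition, there is a constant $\tilde L$ with $$\frac{|T_{z'}-T_{z''}|}{\max\{T_{z'},T_{z''}\}}\le\tilde L\|z'-z''\|\quad\forall z',z''\in Z,$$ then $W$ is continuous on $Z$ with respect to $\rho_H$, and there is a constant $L$ with $d_H(V(z'),V(z''))\le L\|z'-z''\|$ for all $z',z''\in Z$. -/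

import Mathlib

open MeasureTheory ProbabilityTheory Set Filter Topology

/-- The Euclidean space of dimension `n`. -/
abbrev Vec (n : ℕ) : Type := EuclideanSpace ℝ (Fin n)

/-- The data of the control problem with slow observables, with the standing assumptions: the
compact set `U` of control values, the vector fields `f`, `g` of the perturbed system
`y' = f(u,y) + ε g(u,y)`, the running cost `r`, the constants of motion `F` of the reduced system
`y' = f(u,y)`, the compact set `Y` of states and the compact set `Z` of values of `F`. -/
structure SlowObservableSystem (p m k : ℕ) where
  U : Set (Vec p)
  Y : Set (Vec m)
  Z : Set (Vec k)
  f : U → Vec m → Vec m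
  g : U → Vec m → Vec m
  r : U → Vec m → ℝ
  F : Vec m → Vec k
  isCompact_U : IsCompact U
  nonempty_U : U.Nonempty
  isCompact_Y : IsCompact Y
  isCompact_Z : IsCompact Z
  continuous_f : Continuous (fun q : U × Vec m => f q.1 q.2)
  continuous_g : Continuous (fun q : U × Vec m => g q.1 q.2)
  continuous_r : Continuous (fun q : U × Vec m => r q.1 q.2)
  lipschitz_f : ∃ K, ∀ u, LipschitzWith K (f u)
  lipschitz_g : ∃ K, ∀ u, LipschitzWith K (g u)
  lipschitz_r : ∃ K, ∀ u, LipschitzWith K (r u)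
  /-- `F` is differentiable with Lipschitz derivative in a neighbourhood of `Y`. -/
  smooth_F : ∃ O : Set (Vec m), IsOpen O ∧ Y ⊆ O ∧ DifferentiableOn ℝ F O ∧
    ∃ K, LipschitzOnWith K (fderiv ℝ F) O
  /-- The components of `F` are constants of motion of the reduced system: `F'(y) f(u,y) = 0`. -/
  constant_of_motion : ∀ u, ∀ y ∈ Y, fderiv ℝ F y (f u y) = 0
  /-- `Y_z ⊆ Y` for `z ∈ Z`. -/
  levelSet_subset : ∀ z ∈ Z, F ⁻¹' {z} ⊆ Y
  /-- The map `z ↦ Y_z` is Lipschitz on `Z` in the Hausdorff metric. -/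
  levelSet_lipschitz : ∃ L₀ : ℝ, ∀ z' ∈ Z, ∀ z'' ∈ Z,
    Metric.hausdorffEDist (F ⁻¹' {z'}) (F ⁻¹' {z''}) ≤ ENNReal.ofReal (L₀ * ‖z' - z''‖)

/-- The occupational measure generated by `w` on `[0,S]`:
`Q ↦ S⁻¹ * volume {t ∈ [0,S] | w t ∈ Q}`. -/
noncomputable def occupationalMeasure {X : Type*} [MeasurableSpace X] (w : ℝ → X) (S : ℝ) :
    Measure X :=
  (ENNReal.ofReal S)⁻¹ • (volume.restrict (Icc 0 S)).map w

/-- `ρ` is a metric on the probability measures on `X` that is consistent with the weak-star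
topology: `ρ`-convergence of sequences is convergence of the integrals of all continuous
functions (meant for compact metric `X`). -/
def IsWeakStarMetric {X : Type*} [TopologicalSpace X] [MeasurableSpace X]
    (ρ : MetricSpace (ProbabilityMeasure X)) : Prop :=
  ∀ (γ : ℕ → ProbabilityMeasure X) (γ₀ : ProbabilityMeasure X),
    Tendsto (fun n => ρ.dist (γ n) γ₀) atTop (𝓝 0) ↔
      ∀ φ : C(X, ℝ), Tendsto (fun n => ∫ x, φ x ∂(γ n : Measure X)) atTop
        (𝓝 (∫ x, φ x ∂(γ₀ : Measure X)))

/-- `y` solves `y'(t) = f(y(t))` on `[0,∞)`. -/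
def IsSolution {m : ℕ} (f : Vec m → Vec m) (y : ℝ → Vec m) : Prop :=
  ∀ t, 0 ≤ t → HasDerivWithinAt y (f (y t)) (Ici 0) t

namespace SlowObservableSystem

variable {p m k : ℕ}

/-- `y` is the (Carathéodory) solution on `[0,∞)` of the reduced system `y' = f(u,y)` obtained
with the control `u`. -/
def IsControlledSolution (P : SlowObservableSystem p m k) (u : ℝ → P.U) (y : ℝ → Vec m) : Prop :=
  ContinuousOn y (Ici 0) ∧ ∀ t, 0 ≤ t → y t = y 0 + ∫ s in (0 : ℝ)..t, P.f (u s) (y s)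

/-- The set `W(z)` of probability measures `μ` on `U × Y` with support in `U × Y_z` and
`∫ ∇φ(y)ᵀ f(u,y) μ(du,dy) = 0` for all `φ ∈ C¹`. -/
def W (P : SlowObservableSystem p m k) (z : Vec k) : Set (ProbabilityMeasure (P.U × P.Y)) :=
  {μ | (∀ φ : Vec m → ℝ, ContDiff ℝ 1 φ →
      ∫ q in {q : P.U × P.Y | P.F q.2 = z}, fderiv ℝ φ q.2 (P.f q.1 q.2)
        ∂(μ : Measure (P.U × P.Y)) = 0) ∧
    (μ : Measure (P.U × P.Y)).support ⊆ {q | P.F q.2 = z}}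

/-- The averaged vector field `∫ F'(y) g(u,y) μ(du,dy)` of the observables. -/
noncomputable def avgField (P : SlowObservableSystem p m k)
    (μ : ProbabilityMeasure (P.U × P.Y)) : Vec k :=
  ∫ q, fderiv ℝ P.F q.2 (P.g q.1 q.2) ∂(μ : Measure (P.U × P.Y))

/-- The averaged cost `∫ r(u,y) μ(du,dy)`. -/
noncomputable def avgCost (P : SlowObservableSystem p m k)
    (μ : ProbabilityMeasure (P.U × P.Y)) : ℝ :=
  ∫ q, P.r q.1 q.2 ∂(μ : Measure (P.U × P.Y))

/-- The set `V(z)` of the pairs of averaged field and averaged cost over `μ ∈ W(z)`, in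
`ℝᵏ × ℝ` with the Euclidean norm. -/
noncomputable def V (P : SlowObservableSystem p m k) (z : Vec k) : Set (WithLp 2 (Vec k × ℝ)) :=
  (fun μ => WithLp.toLp 2 (P.avgField μ, P.avgCost μ)) '' P.W z

/-- The map `W` is continuous on `Z` (in the Hausdorff metric induced by `ρ`) and the map `V` is
Lipschitz on `Z` in the Hausdorff metric. -/
def AveragedMapsRegular (P : SlowObservableSystem p m k)
    (ρ : MetricSpace (ProbabilityMeasure (P.U × P.Y))) : Prop :=
  (∀ z ∈ P.Z, Tendsto
    (fun z' => @Metric.hausdorffEDist _ ρ.toPseudoMetricSpace.toPseudoEMetricSpace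
      (P.W z') (P.W z)) (𝓝[P.Z] z) (𝓝 0)) ∧
  ∃ L : ℝ, ∀ z' ∈ P.Z, ∀ z'' ∈ P.Z,
    Metric.hausdorffEDist (P.V z') (P.V z'') ≤ ENNReal.ofReal (L * ‖z' - z''‖)

/-- The set of the occupational measures on `[0,S]` of the pairs `(u(·), y(·))`, where `u(·)` is a
(measurable) control and `y(·)` the corresponding solution of the reduced system with
`y(0) = y₀`. -/
def occupationalMeasures (P : SlowObservableSystem p m k) (S : ℝ) (y₀ : Vec m) :
    Set (ProbabilityMeasure (P.U × P.Y)) :=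
  {γ | ∃ (u : ℝ → P.U) (y : ℝ → P.Y), Measurable u ∧
    P.IsControlledSolution u (fun t => (y t : Vec m)) ∧ (y 0 : Vec m) = y₀ ∧
    (γ : Measure (P.U × P.Y)) = occupationalMeasure (fun t => (u t, y t)) S}

/-- Every `μ ∈ W(z)` is approximated, in the metric `ρ`, by the occupational measures on `[0,S]`
with an error at most `β(S) → 0` as `S → ∞`, uniformly in `y₀ ∈ Y_z` and `z ∈ Z`. -/
def UniformlyApproximable (P : SlowObservableSystem p m k)
    (ρ : MetricSpace (ProbabilityMeasure (P.U × P.Y))) : Prop :=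
  ∃ β : ℝ → ℝ, Tendsto β atTop (𝓝 0) ∧
    ∀ S, 0 < S → ∀ z ∈ P.Z, ∀ y₀ : Vec m, P.F y₀ = z → ∀ μ ∈ P.W z,
      @Metric.infEDist _ ρ.toPseudoMetricSpace.toPseudoEMetricSpace μ
        (P.occupationalMeasures S y₀) ≤ ENNReal.ofReal (β S)

/-- For the autonomous system `y' = f(y)` and each `z ∈ Z`, `y z` is a `T z`-periodic solution
contained in `Y_z`, the periods being uniformly bounded, and every solution with initial condition
in `Y_z` is a time shift of it. -/
structure IsPeriodicOrbitFamily (P : SlowObservableSystem p m k) (f : Vec m → Vec m)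
    (T : P.Z → ℝ) (y : P.Z → ℝ → P.Y) : Prop where
  period_pos : ∀ z, 0 < T z
  period_bounded : ∃ T₀, ∀ z, T z ≤ T₀
  periodic : ∀ z, Function.Periodic (y z) (T z)
  mem_levelSet : ∀ z t, P.F (y z t) = z
  isSolution : ∀ z, IsSolution f (fun t => (y z t : Vec m))
  eq_shift : ∀ z : P.Z, ∀ x : ℝ → Vec m, IsSolution f x → P.F (x 0) = z →
    ∃ θ : ℝ, ∀ t, 0 ≤ t → x t = y z (t + θ)

/-- The measures on `U × Y` of the form `σ(du|y) ν(dy)` with `y ↦ σ(·|y)` a Borel measurable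
family of probability measures on `U`. -/
def disintegrated (P : SlowObservableSystem p m k) (ν : Measure P.Y) :
    Set (ProbabilityMeasure (P.U × P.Y)) :=
  {μ | ∃ σ : Kernel P.Y P.U, IsMarkovKernel σ ∧
    (μ : Measure (P.U × P.Y)) = (ν ⊗ₘ σ).map Prod.swap}

end SlowObservableSystem

/-! The core fact is that the occupational measure `ν_z` of the periodic orbit is the only
probability measure on `Y_z` that annihilates `∇φ · f` for all `C¹` functions `φ`. Since `f` ignores
the control, membership in `W(z)` constrains only the marginal on `Y`: it must be `ν_z`
(`mem_W_iff`). Disintegration then gives (i).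

For uniqueness, let `Φ` be the semiflow, `q` Lipschitz and `T = T_z`. The potential `φ(x) = ∫₀ᵀ (T -
s) q(Φ_s x) ds` has derivative `∫₀ᵀ q(Φ_s x) ds - T q(x)` along the flow
(`LipschitzWith.exists_potential`). Every point of `Y_z` lies on the orbit, so there this derivative
equals `T (∫ q dν_z - q(x))`; if it integrates to zero against `ν`, then `∫ q dν = ∫ q dν_z`. As `f`
is merely Lipschitz, `φ` is only known to be Lipschitz, and it is mollified at an arbitrarily small
cost in the derivative along `f` (`LipschitzWith.exists_contDiff_fderiv_apply_near`).

For (ii), `σ(du|y)` read along the orbit is a relaxed control. The state does not react to the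
control, so on each of many short intervals an ordinary control can reproduce the control averages
exactly. The remaining errors come from the motion of the state within these intervals and from an
incomplete last period; both are `O(1/S)` after averaging.

For (iii), two measures are coupled by using the same control at the same fraction of the two
periods. Gronwall's inequality over the bounded period and the hypothesis on the periods bound the
displacement of the state by a multiple of `‖z' - z''‖` (`exists_transport`).

Estimates for Lipschitz test functions pass to `ρ` by compactness of the space of probability
measures (`IsWeakStarMetric.tendsto_dist`). -/

section GlobalExistence

/-! ### Global existence for Lipschitz vector fields. -/

variable {E : Type*} [NormedAddCommGroup E] [NormedSpace ℝ E]

/-- The exponential weight gains the factor `1 / lam` that makes the Picard map contract on the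
whole half-line. -/
theorem exp_neg_mul_norm_integral_le {g : ℝ → E} {C lam τ : ℝ} (hlam : 0 < lam) (hC : 0 ≤ C)
    (hτ : 0 ≤ τ) (hg : ∀ s, 0 ≤ s → ‖g s‖ ≤ C * Real.exp (lam * s)) :
    Real.exp (-(lam * τ)) * ‖∫ s in (0 : ℝ)..τ, g s‖ ≤ C / lam := by
  have hd : ∀ s ∈ uIcc 0 τ, HasDerivAt (fun s => C / lam * Real.exp (lam * s))
      (C * Real.exp (lam * s)) s := by
    intro s _
    have h := (((hasDerivAt_id s).const_mul lam).exp).const_mul (C / lam)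
    have e : C / lam * (Real.exp (lam * s) * (lam * 1)) = C * Real.exp (lam * s) := by
      field_simp
    rw [← e]
    exact h
  have hc : Continuous fun s => C * Real.exp (lam * s) := by fun_prop
  have h1 : ‖∫ s in (0 : ℝ)..τ, g s‖ ≤ ∫ s in (0 : ℝ)..τ, C * Real.exp (lam * s) :=
    intervalIntegral.norm_integral_le_of_norm_le hτ
      (ae_of_all _ fun s hs => hg s hs.1.le) (hc.intervalIntegrable _ _)
  rw [intervalIntegral.integral_eq_sub_of_hasDerivAt hd (hc.intervalIntegrable _ _)] at h1
  have h2 : ‖∫ s in (0 : ℝ)..τ, g s‖ ≤ C / lam * Real.exp (lam * τ) := by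
    refine h1.trans ?_
    simp only [mul_zero, Real.exp_zero, mul_one]
    have : 0 ≤ C / lam := by positivity
    linarith
  calc Real.exp (-(lam * τ)) * ‖∫ s in (0 : ℝ)..τ, g s‖
      ≤ Real.exp (-(lam * τ)) * (C / lam * Real.exp (lam * τ)) := by gcongr
    _ = C / lam * (Real.exp (-(lam * τ)) * Real.exp (lam * τ)) := by ring
    _ = C / lam := by rw [← Real.exp_add]; simp

variable [CompleteSpace E]

/-- Picard iteration in a weighted norm: the unknown is `w t = exp (-lam * t) • x t`, a bounded
function. With `lam = K + 1` the contraction constant is `K / (K + 1)`, so no local solutions have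
to be glued. -/
theorem LipschitzWith.exists_global_solution {f : E → E} {K : NNReal} (hf : LipschitzWith K f)
    (x₀ : E) :
    ∃ x : ℝ → E, Continuous x ∧ x 0 = x₀ ∧
      ∀ t, 0 ≤ t → HasDerivWithinAt x (f (x t)) (Ici 0) t := by
  set lam : ℝ := K + 1 with hlam_def
  have hlam : 0 < lam := by positivity
  have hcont : ∀ w : BoundedContinuousFunction ℝ E,
      Continuous fun s => f (Real.exp (lam * s) • w s) := fun w =>
    hf.continuous.comp (by fun_prop)
  have hpic : ∀ w : BoundedContinuousFunction ℝ E,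
      Continuous fun t => ∫ s in (0 : ℝ)..t, f (Real.exp (lam * s) • w s) := fun w =>
    intervalIntegral.continuous_primitive (fun a b => (hcont w).intervalIntegrable a b) 0
  have hbound : ∀ w : BoundedContinuousFunction ℝ E, ∀ t : ℝ,
      ‖Real.exp (-(lam * max t 0)) •
        (x₀ + ∫ s in (0 : ℝ)..max t 0, f (Real.exp (lam * s) • w s))‖ ≤
        ‖x₀‖ + (‖f 0‖ + K * ‖w‖) / lam := by
    intro w t
    have hτ : 0 ≤ max t 0 := le_max_right _ _
    have he : Real.exp (-(lam * max t 0)) ≤ 1 := Real.exp_le_one_iff.2 (by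
      have := mul_nonneg hlam.le hτ
      linarith)
    have h1 := exp_neg_mul_norm_integral_le (g := fun s => f (Real.exp (lam * s) • w s))
      (C := ‖f 0‖ + K * ‖w‖) hlam (by positivity) hτ (by
        intro s hs
        have h2 : ‖f (Real.exp (lam * s) • w s) - f 0‖ ≤ K * (Real.exp (lam * s) * ‖w‖) := by
          refine (hf.norm_sub_le _ _).trans ?_
          rw [sub_zero, norm_smul, Real.norm_eq_abs, abs_of_pos (Real.exp_pos _)]
          gcongr
          exact w.norm_coe_le_norm s
        have h3 : 1 ≤ Real.exp (lam * s) := Real.one_le_exp (by positivity)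
        have h4 : ‖f (Real.exp (lam * s) • w s)‖ ≤
            ‖f 0‖ + ‖f (Real.exp (lam * s) • w s) - f 0‖ := norm_le_insert' _ _
        have h5 : ‖f 0‖ ≤ ‖f 0‖ * Real.exp (lam * s) := le_mul_of_one_le_right (norm_nonneg _) h3
        nlinarith)
    rw [norm_smul, Real.norm_eq_abs, abs_of_pos (Real.exp_pos _)]
    calc _ ≤ Real.exp (-(lam * max t 0)) *
          (‖x₀‖ + ‖∫ s in (0 : ℝ)..max t 0, f (Real.exp (lam * s) • w s)‖) := by
            gcongr; exact norm_add_le _ _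
      _ = Real.exp (-(lam * max t 0)) * ‖x₀‖ + Real.exp (-(lam * max t 0)) *
          ‖∫ s in (0 : ℝ)..max t 0, f (Real.exp (lam * s) • w s)‖ := by ring
      _ ≤ 1 * ‖x₀‖ + (‖f 0‖ + K * ‖w‖) / lam := by gcongr
      _ = _ := by ring
  -- Negative times are frozen at `0` by `max t 0`, which keeps the functions bounded on all of `ℝ`.
  let next : BoundedContinuousFunction ℝ E → BoundedContinuousFunction ℝ E := fun w =>
    BoundedContinuousFunction.ofNormedAddCommGroup
      (fun t => Real.exp (-(lam * max t 0)) •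
        (x₀ + ∫ s in (0 : ℝ)..max t 0, f (Real.exp (lam * s) • w s)))
      (by
        have := (hpic w).comp (continuous_id.max continuous_const : Continuous fun t : ℝ => max t 0)
        simp only [Function.comp_def, id] at this
        fun_prop)
      _ (hbound w)
  have hcontr : ContractingWith (K / (K + 1)) next := by
    refine ⟨by rw [div_lt_one (by positivity)]; exact lt_add_one K, ?_⟩
    refine LipschitzWith.of_dist_le_mul fun w w' => ?_
    rw [BoundedContinuousFunction.dist_le (by positivity)]
    intro t
    have hτ : 0 ≤ max t 0 := le_max_right _ _
    have h1 := exp_neg_mul_norm_integral_le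
      (g := fun s => f (Real.exp (lam * s) • w s) - f (Real.exp (lam * s) • w' s))
      (C := K * dist w w') hlam (by positivity) hτ (by
        intro s hs
        refine (hf.norm_sub_le _ _).trans ?_
        rw [← smul_sub, norm_smul, Real.norm_eq_abs, abs_of_pos (Real.exp_pos _), ← dist_eq_norm]
        have := BoundedContinuousFunction.dist_coe_le_dist (f := w) (g := w') s
        calc _ ≤ (K : ℝ) * (Real.exp (lam * s) * dist w w') := by gcongr
          _ = _ := by ring)
    rw [intervalIntegral.integral_sub ((hcont w).intervalIntegrable _ _)
      ((hcont w').intervalIntegrable _ _)] at h1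
    change dist (Real.exp (-(lam * max t 0)) •
        (x₀ + ∫ s in (0 : ℝ)..max t 0, f (Real.exp (lam * s) • w s)))
      (Real.exp (-(lam * max t 0)) •
        (x₀ + ∫ s in (0 : ℝ)..max t 0, f (Real.exp (lam * s) • w' s))) ≤ _
    rw [dist_eq_norm, ← smul_sub, norm_smul, Real.norm_eq_abs, abs_of_pos (Real.exp_pos _),
      add_sub_add_left_eq_sub]
    refine h1.trans (le_of_eq ?_)
    push_cast
    rw [hlam_def]
    ring
  obtain ⟨w, hw⟩ : ∃ w, next w = w :=
    ⟨_, hcontr.fixedPoint_isFixedPt⟩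
  have hw' : ∀ t, 0 ≤ t →
      Real.exp (lam * t) • w t = x₀ + ∫ s in (0 : ℝ)..t, f (Real.exp (lam * s) • w s) := by
    intro t ht
    have h : w t = Real.exp (-(lam * max t 0)) •
        (x₀ + ∫ s in (0 : ℝ)..max t 0, f (Real.exp (lam * s) • w s)) :=
      (congrArg (fun v : BoundedContinuousFunction ℝ E => v t) hw).symm
    rw [h, max_eq_left ht, smul_smul, ← Real.exp_add]
    simp
  refine ⟨fun t => Real.exp (lam * t) • w t, by fun_prop, by simpa using hw' 0 le_rfl, ?_⟩
  intro t ht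
  have hd : HasDerivAt (fun t => x₀ + ∫ s in (0 : ℝ)..t, f (Real.exp (lam * s) • w s))
      (f (Real.exp (lam * t) • w t)) t :=
    (intervalIntegral.integral_hasDerivAt_right ((hcont w).intervalIntegrable _ _)
      ((hcont w).stronglyMeasurableAtFilter _ _) (hcont w).continuousAt).const_add _
  exact hd.hasDerivWithinAt.congr (fun s hs => hw' s hs) (hw' t ht)

end GlobalExistence

/-! ### Solutions, semiflow and mollification along a Lipschitz field. -/

namespace IsSolution

variable {m : ℕ} {f : Vec m → Vec m} {x x' : ℝ → Vec m} {K : NNReal}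

theorem continuousOn (h : IsSolution f x) : ContinuousOn x (Ici 0) :=
  fun t ht => (h t ht).continuousWithinAt

theorem dist_le (hf : LipschitzWith K f) (h : IsSolution f x) (h' : IsSolution f x') {t : ℝ}
    (ht : 0 ≤ t) : dist (x t) (x' t) ≤ dist (x 0) (x' 0) * Real.exp (K * t) := by
  have := dist_le_of_trajectories_ODE (v := fun _ => f) (f := x) (g := x') (a := 0) (b := t)
    (fun _ => hf)
    (h.continuousOn.mono Icc_subset_Ici_self)
    (fun s hs => (h s hs.1).mono (Ici_subset_Ici.2 hs.1))
    (h'.continuousOn.mono Icc_subset_Ici_self)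
    (fun s hs => (h' s hs.1).mono (Ici_subset_Ici.2 hs.1)) le_rfl t ⟨ht, le_rfl⟩
  simpa using this

theorem shift (h : IsSolution f x) {a : ℝ} (ha : 0 ≤ a) : IsSolution f (fun t => x (t + a)) := by
  intro t ht
  have h1 := h (t + a) (by positivity)
  have h2 : HasDerivWithinAt (fun t : ℝ => t + a) 1 (Ici 0) t :=
    ((hasDerivAt_id t).add_const a).hasDerivWithinAt
  have := h1.scomp t h2 (fun s hs => show (0 : ℝ) ≤ s + a by simp only [mem_Ici] at hs; positivity)
  simpa [Function.comp_def] using this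

theorem eq_of_eq (hf : LipschitzWith K f) (h : IsSolution f x) (h' : IsSolution f x')
    (h0 : x 0 = x' 0) {t : ℝ} (ht : 0 ≤ t) : x t = x' t := by
  have := dist_le hf h h' ht
  rw [h0, dist_self, zero_mul] at this
  exact dist_le_zero.1 this

end IsSolution

/-- A Lipschitz vector field has a forward semiflow, continuous in time and Lipschitz in space. -/
theorem LipschitzWith.exists_semiflow {m : ℕ} {f : Vec m → Vec m} {K : NNReal}
    (hf : LipschitzWith K f) :
    ∃ Φ : ℝ → Vec m → Vec m, (∀ x, Continuous fun t => Φ t x) ∧ (∀ x, Φ 0 x = x) ∧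
      (∀ x, IsSolution f fun t => Φ t x) ∧
      (∀ s t x, 0 ≤ s → 0 ≤ t → Φ s (Φ t x) = Φ (s + t) x) ∧
      ∀ t, 0 ≤ t → ∀ x x', dist (Φ t x) (Φ t x') ≤ Real.exp (K * t) * dist x x' := by
  choose Ψ hc h0 hs using hf.exists_global_solution
  refine ⟨fun t x => Ψ x t, hc, h0, hs, ?_, ?_⟩
  · intro s t x hs' ht
    refine IsSolution.eq_of_eq hf (hs _) (IsSolution.shift (hs x) ht) ?_ hs'
    simp [h0]
  · intro t ht x x'
    have := IsSolution.dist_le hf (hs x) (hs x') ht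
    rwa [h0, h0, mul_comm] at this

/-- A Lipschitz function with a Lipschitz derivative along a Lipschitz vector field can be
smoothed so that this derivative changes arbitrarily little. -/
theorem LipschitzWith.exists_contDiff_fderiv_apply_near {E : Type*} [NormedAddCommGroup E]
    [InnerProductSpace ℝ E] [FiniteDimensional ℝ E] [MeasurableSpace E] [BorelSpace E]
    {f : E → E} {φ D : E → ℝ} {K L L' : NNReal} (hf : LipschitzWith K f)
    (hφ : LipschitzWith L φ) (hD : LipschitzWith L' D)
    (hc : ∀ x, ∃ c : ℝ → E, c 0 = x ∧ HasDerivWithinAt c (f x) (Ici 0) 0 ∧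
      HasDerivWithinAt (φ ∘ c) (D x) (Ici 0) 0) {δ : ℝ} (hδ : 0 < δ) :
    ∃ ψ : E → ℝ, ContDiff ℝ 1 ψ ∧ ∀ y, |fderiv ℝ ψ y (f y) - D y| ≤ δ := by
  -- Mollification radius: the error below is at most `(L * K + L') * ε`; the `+ 1` keeps the
  -- denominator positive.
  set ε : ℝ := δ / (L * K + L' + 1) with hε_def
  have hε : 0 < ε := by positivity
  let b : ContDiffBump (0 : E) := ⟨ε / 2, ε, by positivity, by linarith⟩
  set η := b.normed volume with hη
  have hηc : Continuous η := b.continuous_normed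
  have hηs : HasCompactSupport η := b.hasCompactSupport_normed
  have hint : ∀ y, Integrable (fun w => η w * φ (y - w)) := fun y => by
    refine Continuous.integrable_of_hasCompactSupport ?_ hηs.mul_right
    exact hηc.mul (hφ.continuous.comp (by fun_prop))
  let ψ : E → ℝ := convolution η φ (ContinuousLinearMap.lsmul ℝ ℝ) volume
  have hψ : ∀ y, ψ y = ∫ w, η w * φ (y - w) := fun y => rfl
  have hψd : ContDiff ℝ 1 ψ :=
    hηs.contDiff_convolution_left _ b.contDiff_normed hφ.continuous.locallyIntegrable
  have hL : ∀ y, LipschitzWith L fun w => φ (y - w) := fun y => by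
    refine LipschitzWith.of_dist_le_mul fun w w' => (hφ.dist_le_mul _ _).trans_eq ?_
    rw [dist_sub_left]
  -- The derivative of the convolution is made to fall on `φ`: by Rademacher's theorem the line
  -- derivative is `∇φ(y - w) · v` for almost every `w`.
  have hline : ∀ y v, fderiv ℝ ψ y v = ∫ w, lineDeriv ℝ (fun w => φ (y - w)) w (-v) * η w := by
    intro y v
    have h1 : Tendsto (fun t : ℝ => t⁻¹ • (ψ (y + t • v) - ψ y)) (𝓝[>] 0)
        (𝓝 (fderiv ℝ ψ y v)) :=
      ((hψd.differentiable one_ne_zero y).hasFDerivAt.hasLineDerivAt v).tendsto_slope_zero_right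
    have h2 := (hL y).integral_inv_smul_sub_mul_tendsto_integral_lineDeriv_mul
      (b.integrable_normed (μ := volume)) (-v)
    refine tendsto_nhds_unique h1 (h2.congr fun t => ?_)
    rw [hψ, hψ, ← integral_sub (hint _) (hint _), ← integral_smul]
    refine integral_congr_ae (ae_of_all _ fun w => ?_)
    have e : y - (w + t • -v) = y + t • v - w := by rw [smul_neg]; abel
    simp only [e, smul_eq_mul]
    ring
  refine ⟨ψ, hψd, fun y => ?_⟩
  have hae : ∀ᵐ w : E, DifferentiableAt ℝ φ (y - w) :=
    (Measure.measurePreserving_sub_left volume y).quasiMeasurePreserving.ae hφ.ae_differentiableAt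
  have hint2 : Integrable fun w => lineDeriv ℝ (fun w => φ (y - w)) w (-f y) * η w := by
    exact b.integrable_normed.bdd_mul ((hL y).memLp_lineDeriv _).1 (c := L * ‖-f y‖)
      (ae_of_all _ fun w => norm_lineDeriv_le_of_lipschitz ℝ (hL y))
  have h1 : fderiv ℝ ψ y (f y) - D y =
      ∫ w, (lineDeriv ℝ (fun w => φ (y - w)) w (-f y) - D y) * η w := by
    simp_rw [sub_mul]
    rw [integral_sub hint2 ((b.integrable_normed).const_mul _), integral_const_mul,
      b.integral_normed, mul_one, hline]
  rw [h1, ← Real.norm_eq_abs]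
  calc _ ≤ ∫ w, δ * η w := by
        refine norm_integral_le_of_norm_le (b.integrable_normed.const_mul _) ?_
        filter_upwards [hae] with w hw
        rw [norm_mul, Real.norm_of_nonneg (b.nonneg_normed w)]
        by_cases hwb : w ∈ Metric.ball (0 : E) ε
        · refine mul_le_mul_of_nonneg_right ?_ (b.nonneg_normed w)
          set x := y - w with hx
          have hld : lineDeriv ℝ (fun w => φ (y - w)) w (-f y) = fderiv ℝ φ x (f y) := by
            rw [← hw.lineDeriv_eq_fderiv, lineDeriv, lineDeriv]
            congr 1
            funext t
            congr 1
            rw [hx, smul_neg]; abel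
          obtain ⟨c, hc0, hc1, hc2⟩ := hc x
          -- Where `φ` is differentiable, the chain rule along the curve `c` gives the derivative in
          -- the direction `f x`. It remains to compare `f y` with `f x` and `D y` with `D x`, at
          -- distance `‖w‖ < ε`.
          have hfx : fderiv ℝ φ x (f x) = D x := by
            have h3 : HasDerivWithinAt (φ ∘ c) (fderiv ℝ φ x (f x)) (Ici 0) 0 := by
              refine HasFDerivAt.comp_hasDerivWithinAt (0 : ℝ) ?_ hc1
              rw [hc0]; exact hw.hasFDerivAt
            exact (uniqueDiffWithinAt_Ici (0 : ℝ)).eq_deriv _ h3 hc2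
          have hwn : ‖w‖ < ε := by simpa using hwb
          have hxy : ‖y - x‖ = ‖w‖ := by rw [hx, sub_sub_cancel]
          have hxy' : ‖x - y‖ = ‖w‖ := by rw [norm_sub_rev, hxy]
          have e1 : fderiv ℝ φ x (f y) - D y = fderiv ℝ φ x (f y - f x) + (D x - D y) := by
            rw [map_sub, hfx]; ring
          rw [hld, e1]
          calc _ ≤ ‖fderiv ℝ φ x (f y - f x)‖ + ‖D x - D y‖ := norm_add_le _ _
            _ ≤ L * (K * ‖w‖) + L' * ‖w‖ := by
                refine add_le_add ?_ ?_
                · refine ((fderiv ℝ φ x).le_opNorm _).trans ?_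
                  gcongr
                  · exact norm_fderiv_le_of_lipschitz ℝ hφ
                  · rw [← hxy]; exact hf.norm_sub_le _ _
                · rw [← hxy']; exact hD.norm_sub_le _ _
            _ = (L * K + L') * ‖w‖ := by ring
            _ ≤ (L * K + L' + 1) * ε := by gcongr ?_ * ?_; exact le_add_of_nonneg_right zero_le_one
            _ = δ := by rw [hε_def]; field_simp
        · have : η w = 0 := by
            by_contra h
            apply hwb
            have h' : w ∈ Function.support (b.normed volume) := h
            rwa [b.support_normed_eq] at h'
          rw [← hη, this, mul_zero, mul_zero]
    _ = δ := by rw [integral_const_mul, b.integral_normed, mul_one]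

/-! ### Occupational measures and the potential of a test function. -/

section OccupationalMeasure

variable {X : Type*} [MeasurableSpace X]

theorem isProbabilityMeasure_occupationalMeasure {w : ℝ → X} (hw : Measurable w) {S : ℝ}
    (hS : 0 < S) : IsProbabilityMeasure (occupationalMeasure w S) := by
  refine ⟨?_⟩
  rw [occupationalMeasure, Measure.smul_apply, Measure.map_apply hw MeasurableSet.univ]
  simp only [preimage_univ, Measure.restrict_apply_univ, Real.volume_Icc, sub_zero, smul_eq_mul]
  exact ENNReal.inv_mul_cancel (by simpa using hS) ENNReal.ofReal_ne_top

theorem integral_occupationalMeasure {G : Type*} [NormedAddCommGroup G] [NormedSpace ℝ G]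
    {w : ℝ → X} (hw : Measurable w) {S : ℝ} (hS : 0 < S) {q : X → G} (hq : StronglyMeasurable q) :
    ∫ x, q x ∂(occupationalMeasure w S) = S⁻¹ • ∫ t in (0 : ℝ)..S, q (w t) := by
  rw [occupationalMeasure, integral_smul_measure, integral_map hw.aemeasurable
    hq.aestronglyMeasurable, intervalIntegral.integral_of_le hS.le,
    integral_Icc_eq_integral_Ioc, ENNReal.toReal_inv, ENNReal.toReal_ofReal hS.le]

end OccupationalMeasure

/-- The Lipschitz potential whose derivative along the flow is the average of `q` over `[0,T]`
minus `q`, up to the factor `T`. -/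
theorem LipschitzWith.exists_potential {m : ℕ} {f : Vec m → Vec m} {K : NNReal} (hf : LipschitzWith K f)
    {q : Vec m → ℝ} {L : NNReal} (hq : LipschitzWith L q) {T : ℝ} (hT : 0 < T) :
    ∃ (φ D : Vec m → ℝ) (L₁ L₂ : NNReal), LipschitzWith L₁ φ ∧ LipschitzWith L₂ D ∧
      (∀ x, ∃ c : ℝ → Vec m, c 0 = x ∧ HasDerivWithinAt c (f x) (Ici 0) 0 ∧
        HasDerivWithinAt (φ ∘ c) (D x) (Ici 0) 0) ∧
      ∀ x : ℝ → Vec m, IsSolution f x → D (x 0) = (∫ s in (0 : ℝ)..T, q (x s)) - T * q (x 0) := by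
  obtain ⟨Φ, hΦc, hΦ0, hΦs, hΦadd, hΦL⟩ := hf.exists_semiflow
  have hpc : ∀ x, Continuous fun s => q (Φ s x) := fun x => hq.continuous.comp (hΦc x)
  have hqd : ∀ s ∈ Icc 0 T, ∀ x x',
      ‖q (Φ s x) - q (Φ s x')‖ ≤ L * Real.exp (K * T) * dist x x' := by
    intro s hs x x'
    rw [← dist_eq_norm, mul_assoc]
    refine (hq.dist_le_mul _ _).trans ?_
    gcongr
    refine (hΦL s hs.1 x x').trans ?_
    gcongr
    exact hs.2
  have hI : ∀ x x', ‖(∫ s in (0 : ℝ)..T, q (Φ s x)) - ∫ s in (0 : ℝ)..T, q (Φ s x')‖ ≤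
      L * Real.exp (K * T) * dist x x' * T := by
    intro x x'
    rw [← intervalIntegral.integral_sub ((hpc x).intervalIntegrable _ _)
      ((hpc x').intervalIntegrable _ _)]
    refine (intervalIntegral.norm_integral_le_of_norm_le_const (C := L * Real.exp (K * T) *
      dist x x') fun s hs => ?_).trans_eq ?_
    · rw [uIoc_of_le hT.le] at hs
      exact hqd s ⟨hs.1.le, hs.2⟩ x x'
    · rw [sub_zero, abs_of_pos hT]
  have hJ : ∀ x, Continuous fun s => (T - s) * q (Φ s x) := fun x =>
    (continuous_const.sub continuous_id).mul (hpc x)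
  -- The weight `T - s` vanishes at `s = T` and equals `T` at `s = 0`, so differentiation along the
  -- flow leaves the unweighted integral and the single boundary term `-T * q x`.
  refine ⟨fun x => ∫ s in (0 : ℝ)..T, (T - s) * q (Φ s x),
    fun x => (∫ s in (0 : ℝ)..T, q (Φ s x)) - T * q x,
    Real.toNNReal (T * (L * Real.exp (K * T)) * T),
    Real.toNNReal (L * Real.exp (K * T) * T + T * L), ?_, ?_, ?_, ?_⟩
  · refine LipschitzWith.of_dist_le' fun x x' => ?_
    rw [dist_eq_norm, ← intervalIntegral.integral_sub ((hJ x).intervalIntegrable _ _)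
      ((hJ x').intervalIntegrable _ _)]
    refine (intervalIntegral.norm_integral_le_of_norm_le_const (C := T * (L * Real.exp (K * T) *
      dist x x')) fun s hs => ?_).trans_eq ?_
    · rw [uIoc_of_le hT.le] at hs
      rw [← mul_sub, norm_mul]
      refine mul_le_mul ?_ (hqd s ⟨hs.1.le, hs.2⟩ x x') (norm_nonneg _) hT.le
      rw [Real.norm_eq_abs, abs_of_nonneg (by linarith [hs.2])]
      linarith [hs.1]
    · rw [sub_zero, abs_of_pos hT]; ring
  · refine LipschitzWith.of_dist_le' fun x x' => ?_
    rw [dist_eq_norm, sub_sub_sub_comm, ← mul_sub]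
    refine (_root_.norm_sub_le _ _).trans ?_
    rw [add_mul, norm_mul, Real.norm_of_nonneg hT.le, mul_assoc T]
    refine add_le_add ((hI x x').trans_eq (by ring)) ?_
    gcongr
    rw [← dist_eq_norm]
    exact hq.dist_le_mul _ _
  · intro x
    refine ⟨fun h => Φ h x, hΦ0 x, by simpa [hΦ0] using hΦs x 0 le_rfl, ?_⟩
    set g : ℝ → ℝ := fun s => q (Φ s x) with hg
    have hgc : Continuous g := hpc x
    have hg1c : Continuous fun s => s * g s := continuous_id.mul hgc
    have hA : ∀ u, HasDerivAt (fun u => ∫ s in (0 : ℝ)..u, g s) (g u) u := fun u =>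
      intervalIntegral.integral_hasDerivAt_right (hgc.intervalIntegrable _ _)
        (hgc.stronglyMeasurableAtFilter _ _) hgc.continuousAt
    have hB : ∀ u, HasDerivAt (fun u => ∫ s in (0 : ℝ)..u, s * g s) (u * g u) u := fun u =>
      intervalIntegral.integral_hasDerivAt_right (hg1c.intervalIntegrable _ _)
        (hg1c.stronglyMeasurableAtFilter _ _) hg1c.continuousAt
    have hT0 : HasDerivAt (fun h : ℝ => T + h) 1 0 := (hasDerivAt_id 0).const_add T
    have hAT : HasDerivAt (fun h => ∫ s in (0 : ℝ)..(T + h), g s) (g T) 0 := by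
      have := HasDerivAt.comp (0 : ℝ) (h₂ := fun u => ∫ s in (0 : ℝ)..u, g s)
        (h := fun h => T + h) (by simpa using hA T) hT0
      simpa [Function.comp_def] using this
    have hBT : HasDerivAt (fun h => ∫ s in (0 : ℝ)..(T + h), s * g s) (T * g T) 0 := by
      have := HasDerivAt.comp (0 : ℝ) (h₂ := fun u => ∫ s in (0 : ℝ)..u, s * g s)
        (h := fun h => T + h) (by simpa using hB T) hT0
      simpa [Function.comp_def] using this
    have key := (hT0.mul (hAT.sub (hA 0))).sub (hBT.sub (hB 0))
    -- By the semigroup law the potential at `Φ h x` is the integral of `(T + h - s) * g s` over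
    -- `[h, T + h]`. In the expanded form `h` enters only through the limits and the factor `T + h`,
    -- so `q` is never differentiated.
    have key2 : HasDerivAt (fun h => (T + h) * ((∫ s in (0 : ℝ)..(T + h), g s) -
        ∫ s in (0 : ℝ)..h, g s) - ((∫ s in (0 : ℝ)..(T + h), s * g s) -
        ∫ s in (0 : ℝ)..h, s * g s)) ((∫ s in (0 : ℝ)..T, g s) - T * q x) 0 := by
      refine key.congr_deriv ?_
      have : g 0 = q x := by simp [hg, hΦ0]
      simp [this]
      ring
    refine key2.hasDerivWithinAt.congr_of_mem (fun h hh => ?_) self_mem_Ici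
    have hh' : (0 : ℝ) ≤ h := hh
    have e1 : ∫ s in (0 : ℝ)..T, (T - s) * q (Φ s (Φ h x)) =
        ∫ s in (0 : ℝ)..T, (T + h - (s + h)) * g (s + h) := by
      refine intervalIntegral.integral_congr fun s hs => ?_
      rw [uIcc_of_le hT.le] at hs
      simp only [hg]
      rw [hΦadd s h x hs.1 hh']
      ring
    have e2 : ∀ a b : ℝ, ∫ s in a..b, (T + h - s) * g s =
        (T + h) * (∫ s in a..b, g s) - ∫ s in a..b, s * g s := by
      intro a b
      simp_rw [sub_mul]
      rw [intervalIntegral.integral_sub ((hgc.const_mul _).intervalIntegrable _ _)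
        (hg1c.intervalIntegrable _ _), intervalIntegral.integral_const_mul]
    simp only [Function.comp_apply]
    rw [e1, intervalIntegral.integral_comp_add_right (fun s => (T + h - s) * g s), zero_add, e2,
      intervalIntegral.integral_interval_sub_left (hgc.intervalIntegrable _ _)
        (hgc.intervalIntegrable _ _),
      intervalIntegral.integral_interval_sub_left (hg1c.intervalIntegrable _ _)
        (hg1c.intervalIntegrable _ _)]
  · intro x hx
    refine congrArg (· - T * q (x 0)) ?_
    refine intervalIntegral.integral_congr fun s hs => ?_
    rw [uIcc_of_le hT.le] at hs
    exact congrArg q (IsSolution.eq_of_eq hf (hΦs (x 0)) hx (hΦ0 _) hs.1)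

/-! ### Basic properties of the system and of the periodic orbits. -/

namespace SlowObservableSystem

variable {p m k : ℕ} (P : SlowObservableSystem p m k)

instance : CompactSpace P.U := isCompact_iff_compactSpace.1 P.isCompact_U

instance : CompactSpace P.Y := isCompact_iff_compactSpace.1 P.isCompact_Y

instance : Nonempty P.U := P.nonempty_U.to_subtype

instance : StandardBorelSpace P.U := P.isCompact_U.isClosed.measurableSet.standardBorel

instance : StandardBorelSpace P.Y := P.isCompact_Y.isClosed.measurableSet.standardBorel

theorem continuous_F : Continuous fun y : P.Y => P.F y := by
  obtain ⟨O, _, hYO, hF, _⟩ := P.smooth_F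
  exact continuousOn_iff_continuous_domRestrict.1 (hF.continuousOn.mono hYO)

theorem isClosed_levelSet (z : Vec k) : IsClosed {y : P.Y | P.F y = z} :=
  isClosed_eq P.continuous_F continuous_const

variable {P}

theorem exists_lipschitzWith_of_forall_eq {f : Vec m → Vec m} (hf : ∀ u y, P.f u y = f y) :
    ∃ K, LipschitzWith K f := by
  obtain ⟨K, hK⟩ := P.lipschitz_f
  obtain ⟨u⟩ : Nonempty P.U := inferInstance
  have : P.f u = f := funext (hf u)
  exact ⟨K, this ▸ hK u⟩

namespace IsPeriodicOrbitFamily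

variable {f : Vec m → Vec m} {T : P.Z → ℝ} {y : P.Z → ℝ → P.Y}

/-- `IsSolution` only gives derivatives within `[0,∞)`; adding enough periods moves any real time
into the interior. -/
theorem hasDerivAt (hy : P.IsPeriodicOrbitFamily f T y) (z : P.Z) (t : ℝ) :
    HasDerivAt (fun t => (y z t : Vec m)) (f (y z t)) t := by
  obtain ⟨n, hn⟩ := exists_nat_gt (-t / T z)
  have hpos : 0 < t + n * T z := by
    rw [div_lt_iff₀ (hy.period_pos z)] at hn
    linarith
  have hper : ∀ t, y z (t + n * T z) = y z t := fun t => (hy.periodic z).nat_mul n t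
  have h1 := (hy.isSolution z (t + n * T z) hpos.le).hasDerivAt (Ici_mem_nhds hpos)
  have h2 := h1.comp_add_const t (n * T z)
  simp only [hper] at h2
  exact h2

theorem continuous (hy : P.IsPeriodicOrbitFamily f T y) (z : P.Z) : Continuous (y z) :=
  continuous_induced_rng.2
    (continuous_iff_continuousAt.2 fun t => (hy.hasDerivAt z t).continuousAt)

theorem isSolution_shift (hy : P.IsPeriodicOrbitFamily f T y) (z : P.Z) (θ : ℝ) :
    IsSolution f (fun t => (y z (t + θ) : Vec m)) := fun t _ =>
  ((hy.hasDerivAt z (t + θ)).comp_add_const t θ).hasDerivWithinAt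

/-- The shift hypothesis speaks of solutions, not of points; global existence supplies a solution
from `y₀`, and its shift is read off at time `0`. -/
theorem exists_time (hf : ∃ K, LipschitzWith K f) (hy : P.IsPeriodicOrbitFamily f T y) (z : P.Z)
    {y₀ : Vec m} (h : P.F y₀ = z) : ∃ θ, (y z θ : Vec m) = y₀ := by
  obtain ⟨K, hK⟩ := hf
  obtain ⟨x, _, hx0, hx⟩ := hK.exists_global_solution y₀
  obtain ⟨θ, hθ⟩ := hy.eq_shift z x hx (by rw [hx0, h])
  exact ⟨θ, by rw [← hx0, hθ 0 le_rfl, zero_add]⟩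

theorem isProbabilityMeasure (hy : P.IsPeriodicOrbitFamily f T y) (z : P.Z) :
    IsProbabilityMeasure (occupationalMeasure (y z) (T z)) :=
  isProbabilityMeasure_occupationalMeasure (hy.continuous z).measurable (hy.period_pos z)

theorem integral_shift (hy : P.IsPeriodicOrbitFamily f T y) (z : P.Z) (θ : ℝ)
    {G : Type*} [NormedAddCommGroup G] [NormedSpace ℝ G] {q : P.Y → G}
    (hq : StronglyMeasurable q) :
    ∫ t in (0 : ℝ)..T z, q (y z (t + θ)) =
      T z • ∫ x, q x ∂(occupationalMeasure (y z) (T z)) := by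
  rw [integral_occupationalMeasure (hy.continuous z).measurable (hy.period_pos z) hq, smul_smul,
    mul_inv_cancel₀ (hy.period_pos z).ne', one_smul,
    intervalIntegral.integral_comp_add_right (fun t => q (y z t)), zero_add, add_comm (T z)]
  have := ((hy.periodic z).comp q).intervalIntegral_add_eq θ 0
  simpa using this

end IsPeriodicOrbitFamily

end SlowObservableSystem

/-- Lipschitz functions on a bounded metric space determine Borel probability measures. -/
theorem MeasureTheory.ProbabilityMeasure.eq_of_forall_lipschitz_integral_eq {X : Type*}
    [MetricSpace X] [MeasurableSpace X] [BorelSpace X] {μ ν : ProbabilityMeasure X}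
    (h : ∀ q : X → ℝ, (∃ L, LipschitzWith L q) →
      ∫ x, q x ∂(μ : Measure X) = ∫ x, q x ∂(ν : Measure X)) : μ = ν := by
  have : Tendsto (fun _ : ℕ => μ) atTop (𝓝 ν) := by
    rw [tendsto_iff_forall_lipschitz_integral_tendsto]
    intro q _ hq
    rw [h q hq]
    exact tendsto_const_nhds
  exact tendsto_nhds_unique tendsto_const_nhds this

theorem Continuous.integrable_of_compactSpace {X G : Type*} [TopologicalSpace X] [CompactSpace X]
    [MeasurableSpace X] [OpensMeasurableSpace X] [NormedAddCommGroup G]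
    [SecondCountableTopologyEither X G] {q : X → G}
    (hq : Continuous q) (μ : Measure X) [IsFiniteMeasure μ] : Integrable q μ := by
  obtain ⟨C, hC⟩ := (isCompact_range hq).isBounded.exists_norm_le
  exact Integrable.of_bound hq.aestronglyMeasurable C (ae_of_all _ fun x => hC _ (mem_range_self x))

/-! ### Uniqueness of the invariant measure and the description of `W`. -/

namespace SlowObservableSystem

variable {p m k : ℕ} {P : SlowObservableSystem p m k}

namespace IsPeriodicOrbitFamily

variable {f : Vec m → Vec m} {T : P.Z → ℝ} {y : P.Z → ℝ → P.Y}

/-- The occupational measure of the periodic orbit in `Y_z` is the only probability measure on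
`Y_z` that annihilates the derivatives of `C¹` functions along the vector field. -/
theorem eq_occupationalMeasure (hf : ∃ K, LipschitzWith K f) (hy : P.IsPeriodicOrbitFamily f T y)
    (z : P.Z) (ν : Measure P.Y) [IsProbabilityMeasure ν]
    (h1 : ∀ φ : Vec m → ℝ, ContDiff ℝ 1 φ → ∫ x : P.Y, fderiv ℝ φ x (f x) ∂ν = 0)
    (h2 : ∀ᵐ x : P.Y ∂ν, P.F x = z) : ν = occupationalMeasure (y z) (T z) := by
  have hprob := hy.isProbabilityMeasure z
  have hTz := hy.period_pos z
  suffices h : (⟨ν, inferInstance⟩ : ProbabilityMeasure P.Y) =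
      ⟨occupationalMeasure (y z) (T z), hprob⟩ from congrArg Subtype.val h
  refine ProbabilityMeasure.eq_of_forall_lipschitz_integral_eq fun q ⟨L, hq⟩ => ?_
  simp only [ProbabilityMeasure.coe_mk]
  -- The potential and its mollification live on the whole space, so `q` is first extended from `Y`.
  obtain ⟨q', hq', hqq'⟩ : ∃ q' : Vec m → ℝ, LipschitzWith L q' ∧ ∀ x : P.Y, q x = q' x := by
    classical
    have hext : LipschitzOnWith L (fun x => if hx : x ∈ P.Y then q ⟨x, hx⟩ else 0) P.Y := by
      intro a ha b hb
      simpa [ha, hb] using hq ⟨a, ha⟩ ⟨b, hb⟩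
    obtain ⟨g, hg, hge⟩ := hext.extend_real
    refine ⟨g, hg, fun x => ?_⟩
    rw [← hge x.2]
    simp
  obtain ⟨K, hK⟩ := hf
  obtain ⟨φ, D, L₁, L₂, hφ, hD, hc, hDx⟩ := hK.exists_potential hq' hTz
  have hDc : Continuous fun x : P.Y => D x := hD.continuous.comp continuous_subtype_val
  have hqc : Continuous q := hq.continuous
  -- `D` need not come from a `C¹` function, but it is uniformly within every `δ > 0` of a
  -- derivative that integrates to zero.
  have hD0 : ∫ x : P.Y, D x ∂ν = 0 := by
    refine abs_eq_zero.1 (le_antisymm (le_of_forall_pos_le_add fun δ hδ => ?_) (abs_nonneg _))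
    obtain ⟨ψ, hψ, hψD⟩ := hK.exists_contDiff_fderiv_apply_near hφ hD hc hδ
    have hψc : Continuous fun x : P.Y => fderiv ℝ ψ x (f x) :=
      ((hψ.continuous_fderiv one_ne_zero).comp continuous_subtype_val).clm_apply
        (hK.continuous.comp continuous_subtype_val)
    have h3 : ∫ x : P.Y, D x ∂ν = ∫ x : P.Y, (D x - fderiv ℝ ψ x (f x)) ∂ν := by
      rw [integral_sub (hDc.integrable_of_compactSpace ν) (hψc.integrable_of_compactSpace ν),
        h1 ψ hψ, sub_zero]
    rw [h3, ← Real.norm_eq_abs, zero_add]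
    refine (norm_integral_le_of_norm_le_const (C := δ) (ae_of_all _ fun x => ?_)).trans_eq ?_
    · rw [Real.norm_eq_abs, abs_sub_comm]
      exact hψD x
    · simp
  -- Periodicity enters here: on `Y_z` the integral of `q` over one period does not depend on the
  -- starting point.
  have hDν : ∀ᵐ x : P.Y ∂ν, D x =
      T z * ∫ x, q x ∂(occupationalMeasure (y z) (T z)) - T z * q x := by
    filter_upwards [h2] with x hx
    obtain ⟨θ, hθ⟩ := hy.exists_time ⟨K, hK⟩ z hx
    have hs := hDx _ (hy.isSolution_shift z θ)
    simp only [zero_add, hθ] at hs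
    rw [hs, hqq' x]
    congr 1
    have h4 := hy.integral_shift z θ hqc.stronglyMeasurable
    rw [smul_eq_mul] at h4
    rw [← h4]
    simp only [hqq']
  rw [integral_congr_ae hDν, integral_sub (integrable_const _)
    ((hqc.integrable_of_compactSpace ν).const_mul _)] at hD0
  simp only [integral_const_mul, integral_const, probReal_univ, one_smul] at hD0
  have h5 := mul_left_cancel₀ hTz.ne' (sub_eq_zero.1 hD0)
  exact h5.symm

/-- Both conditions defining `W` see only the state, hence only the marginal on `Y`. One direction
is uniqueness of the invariant measure, the other the fundamental theorem of calculus over a closed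
orbit. -/
theorem mem_W_iff (hf : ∀ u y, P.f u y = f y) (hy : P.IsPeriodicOrbitFamily f T y) (z : P.Z)
    (μ : ProbabilityMeasure (P.U × P.Y)) :
    μ ∈ P.W z ↔ (μ : Measure (P.U × P.Y)).map Prod.snd = occupationalMeasure (y z) (T z) := by
  have hfL := exists_lipschitzWith_of_forall_eq hf
  have hfc : Continuous f := hfL.choose_spec.continuous
  have hcl : IsClosed {q : P.U × P.Y | P.F q.2 = z} :=
    (P.isClosed_levelSet z).preimage continuous_snd
  have hint : ∀ φ : Vec m → ℝ, ContDiff ℝ 1 φ → (∀ᵐ q ∂(μ : Measure (P.U × P.Y)), P.F q.2 = z) →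
      ∫ q in {q : P.U × P.Y | P.F q.2 = z}, fderiv ℝ φ q.2 (P.f q.1 q.2)
        ∂(μ : Measure (P.U × P.Y)) =
      ∫ x : P.Y, fderiv ℝ φ x (f x) ∂((μ : Measure (P.U × P.Y)).map Prod.snd) := by
    intro φ hφ hae
    have hc : Continuous fun x : P.Y => fderiv ℝ φ x (f x) :=
      ((hφ.continuous_fderiv one_ne_zero).comp continuous_subtype_val).clm_apply
        (hfc.comp continuous_subtype_val)
    rw [integral_map measurable_snd.aemeasurable hc.aestronglyMeasurable,
      Measure.restrict_eq_self_of_ae_mem (s := {q : P.U × P.Y | P.F q.2 = z}) hae]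
    simp only [hf]
  constructor
  · rintro ⟨h1, h2⟩
    have hae : ∀ᵐ q ∂(μ : Measure (P.U × P.Y)), P.F q.2 = z :=
      mem_of_superset Measure.support_mem_ae h2
    have : IsProbabilityMeasure ((μ : Measure (P.U × P.Y)).map Prod.snd) :=
      Measure.isProbabilityMeasure_map measurable_snd.aemeasurable
    refine hy.eq_occupationalMeasure hfL z _ (fun φ hφ => by rw [← hint φ hφ hae, h1 φ hφ]) ?_
    rw [ae_map_iff measurable_snd.aemeasurable (P.isClosed_levelSet z).measurableSet]
    exact hae
  · intro h
    have hae : ∀ᵐ q ∂(μ : Measure (P.U × P.Y)), P.F q.2 = z := by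
      have h3 : ∀ᵐ x : P.Y ∂((μ : Measure (P.U × P.Y)).map Prod.snd), P.F x = z := by
        rw [h, occupationalMeasure]
        refine Measure.ae_smul_measure ?_ _
        rw [ae_map_iff (hy.continuous z).measurable.aemeasurable
          (P.isClosed_levelSet z).measurableSet]
        exact ae_of_all _ (hy.mem_levelSet z)
      exact ae_of_ae_map measurable_snd.aemeasurable h3
    refine ⟨fun φ hφ => ?_, Measure.support_subset_of_isClosed hcl hae⟩
    have hφc : Continuous fun x : Vec m => fderiv ℝ φ x (f x) :=
      (hφ.continuous_fderiv one_ne_zero).clm_apply hfc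
    have hφY : Continuous fun x : P.Y => fderiv ℝ φ x (f x) := hφc.comp continuous_subtype_val
    rw [hint φ hφ hae, h, integral_occupationalMeasure (hy.continuous z).measurable
      (hy.period_pos z) hφY.stronglyMeasurable]
    have hd : ∀ t ∈ uIcc 0 (T z), HasDerivAt (fun t => φ (y z t))
        (fderiv ℝ φ (y z t) (f (y z t))) t := fun t _ =>
      (hφ.differentiable one_ne_zero _).hasFDerivAt.comp_hasDerivAt t (hy.hasDerivAt z t)
    have hc : Continuous fun t => fderiv ℝ φ (y z t) (f (y z t)) :=
      hφc.comp (continuous_subtype_val.comp (hy.continuous z))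
    have h4 := intervalIntegral.integral_eq_sub_of_hasDerivAt hd (hc.intervalIntegrable _ _)
    have h5 : y z (T z) = y z 0 := (hy.periodic z).eq
    rw [h4, h5, sub_self, smul_zero]

theorem W_eq_disintegrated (hf : ∀ u y, P.f u y = f y) (hy : P.IsPeriodicOrbitFamily f T y)
    (z : P.Z) : P.W z = P.disintegrated (occupationalMeasure (y z) (T z)) := by
  have := hy.isProbabilityMeasure z
  ext μ
  rw [hy.mem_W_iff hf z]
  constructor
  · intro h
    -- `condKernel` conditions on the first factor, whereas the state is the second one.
    set μ' := (μ : Measure (P.U × P.Y)).map Prod.swap with hμ'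
    have : IsProbabilityMeasure μ' := Measure.isProbabilityMeasure_map measurable_swap.aemeasurable
    refine ⟨μ'.condKernel, inferInstance, ?_⟩
    have hfst : μ'.fst = occupationalMeasure (y z) (T z) := by
      rw [← h, Measure.fst, hμ', Measure.map_map measurable_fst measurable_swap]
      rfl
    rw [← hfst, μ'.disintegrate, hμ', Measure.map_map measurable_swap measurable_swap,
      Prod.swap_swap_eq, Measure.map_id]
  · rintro ⟨σ, hσ, h⟩
    rw [h, Measure.map_map measurable_snd measurable_swap]
    exact Measure.fst_compProd _ σ

end IsPeriodicOrbitFamily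

end SlowObservableSystem

/-! ### Metrics consistent with the weak-star topology. -/

section WeakStarMetric

variable {X : Type*} [MetricSpace X] [CompactSpace X] [MeasurableSpace X] [BorelSpace X]
  {ρ : MetricSpace (ProbabilityMeasure X)}

theorem IsWeakStarMetric.tendsto_dist_of_tendsto (hρ : IsWeakStarMetric ρ)
    {γ : ℕ → ProbabilityMeasure X} {γ₀ : ProbabilityMeasure X} (h : Tendsto γ atTop (𝓝 γ₀)) :
    Tendsto (fun n => ρ.dist (γ n) γ₀) atTop (𝓝 0) := by
  rw [hρ γ γ₀]
  intro φ
  exact ProbabilityMeasure.tendsto_iff_forall_integral_tendsto.1 h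
    (BoundedContinuousFunction.mkOfCompact φ)

theorem IsWeakStarMetric.continuous_dist (hρ : IsWeakStarMetric ρ) :
    Continuous fun q : ProbabilityMeasure X × ProbabilityMeasure X => ρ.dist q.1 q.2 := by
  refine SeqContinuous.continuous fun q q₀ hq => ?_
  have h1 := hρ.tendsto_dist_of_tendsto ((continuous_fst.tendsto q₀).comp hq)
  have h2 := hρ.tendsto_dist_of_tendsto ((continuous_snd.tendsto q₀).comp hq)
  have h3 := h1.add h2
  rw [add_zero] at h3
  refine tendsto_iff_dist_tendsto_zero.2
    (squeeze_zero (fun n => dist_nonneg) (fun n => ?_) h3)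
  exact @dist_dist_dist_le _ ρ.toPseudoMetricSpace _ _ _ _

/-- A metric consistent with the weak-star topology is small as soon as the differences of the
integrals of Lipschitz functions are, uniformly in the measures. -/
theorem IsWeakStarMetric.tendsto_dist (hρ : IsWeakStarMetric ρ) {ι : Type*} {l : Filter ι}
    {μ γ : ι → ProbabilityMeasure X}
    (h : ∀ q : X → ℝ, (∃ L, LipschitzWith L q) → Tendsto
      (fun i => ∫ x, q x ∂(μ i : Measure X) - ∫ x, q x ∂(γ i : Measure X)) l (𝓝 0)) :
    Tendsto (fun i => ρ.dist (μ i) (γ i)) l (𝓝 0) := by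
  -- Along an ultrafilter both families converge by compactness. The hypothesis forces the two
  -- limits to agree, and `ρ` is jointly continuous.
  rw [tendsto_iff_ultrafilter]
  intro g hg
  obtain ⟨⟨μ₀, γ₀⟩, -, h₀⟩ := isCompact_univ.ultrafilter_le_nhds
    (g.map fun i => (μ i, γ i)) (by simp)
  have h₀' : Tendsto (fun i => (μ i, γ i)) g (𝓝 (μ₀, γ₀)) := h₀
  have hμ : Tendsto μ g (𝓝 μ₀) := (continuous_fst.tendsto (μ₀, γ₀)).comp h₀'
  have hγ : Tendsto γ g (𝓝 γ₀) := (continuous_snd.tendsto (μ₀, γ₀)).comp h₀'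
  have heq : μ₀ = γ₀ := by
    refine ProbabilityMeasure.eq_of_forall_lipschitz_integral_eq fun q hq => ?_
    let q' : BoundedContinuousFunction X ℝ :=
      BoundedContinuousFunction.mkOfCompact ⟨q, hq.choose_spec.continuous⟩
    have h1 := ProbabilityMeasure.tendsto_iff_forall_integral_tendsto.1 hμ q'
    have h2 := ProbabilityMeasure.tendsto_iff_forall_integral_tendsto.1 hγ q'
    exact sub_eq_zero.1 (tendsto_nhds_unique (h1.sub h2) ((h q hq).mono_left hg))
  have h3 := (hρ.continuous_dist.tendsto (μ₀, γ₀)).comp h₀'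
  have h4 : ρ.dist μ₀ γ₀ = 0 := by
    rw [heq]
    exact @dist_self _ ρ.toPseudoMetricSpace _
  simp only [h4] at h3
  exact h3

end WeakStarMetric

/-! ### Coupling of measures on different orbits; regularity of `W` and `V`. -/

section Coupling

/-- Rescaling time to `[0,1]` puts orbits with different periods on one probability space. -/
theorem occupationalMeasure_eq_map {X : Type*} [MeasurableSpace X] {w : ℝ → X} (hw : Measurable w)
    {S : ℝ} (hS : 0 < S) :
    occupationalMeasure w S = (volume.restrict (Icc (0 : ℝ) 1)).map (fun s => w (S * s)) := by
  have hm : Measurable fun s : ℝ => S * s := measurable_const_mul S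
  have h1 : (volume.restrict (Icc (0 : ℝ) 1)).map (fun s => S * s) =
      (ENNReal.ofReal S)⁻¹ • volume.restrict (Icc 0 S) := by
    have hpre : Icc (0 : ℝ) 1 = (fun s => S * s) ⁻¹' Icc 0 S := by
      rw [preimage_const_mul_Icc₀ _ _ hS, zero_div, div_self hS.ne']
    rw [hpre, ← Measure.restrict_map hm measurableSet_Icc, Real.map_volume_mul_left hS.ne',
      Measure.restrict_smul, abs_of_pos (inv_pos.2 hS), ENNReal.ofReal_inv_of_pos hS]
  have h2 : (fun s => w (S * s)) = w ∘ fun s => S * s := rfl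
  rw [h2, ← Measure.map_map hw hm, h1, Measure.map_smul, occupationalMeasure]

/-- Used to draw the control given the time parameter instead of given the point on the orbit. -/
theorem MeasureTheory.Measure.compProd_map_left {A B C : Type*} [MeasurableSpace A]
    [MeasurableSpace B] [MeasurableSpace C] (μ : Measure A) [SFinite μ] {g : A → B}
    (hg : Measurable g) (κ : Kernel B C) [IsSFiniteKernel κ] :
    (μ.map g) ⊗ₘ κ = (μ ⊗ₘ (κ.comap g hg)).map (Prod.map g id) := by
  ext s hs
  rw [Measure.map_apply (hg.prodMap measurable_id) hs, Measure.compProd_apply hs,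
    Measure.compProd_apply (hg.prodMap measurable_id hs),
    lintegral_map (Kernel.measurable_kernel_prodMk_left hs) hg]
  rfl

end Coupling

theorem WithLp.dist_prod_two_le {A B : Type*} [SeminormedAddCommGroup A] [SeminormedAddCommGroup B]
    (x x' : WithLp 2 (A × B)) : dist x x' ≤ dist x.fst x'.fst + dist x.snd x'.snd := by
  rw [WithLp.prod_dist_eq_of_L2]
  refine Real.sqrt_le_iff.2 ⟨by positivity, ?_⟩
  have h1 : 0 ≤ dist x.fst x'.fst := dist_nonneg
  have h2 : 0 ≤ dist x.snd x'.snd := dist_nonneg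
  nlinarith [mul_nonneg h1 h2]

namespace SlowObservableSystem

variable {p m k : ℕ} (P : SlowObservableSystem p m k)

theorem isCompact_levelSet {z : Vec k} (hz : z ∈ P.Z) : IsCompact (P.F ⁻¹' {z}) := by
  have h := ((P.isClosed_levelSet z).isCompact).image continuous_subtype_val
  convert h using 1
  ext x
  constructor
  · intro hx
    exact ⟨⟨x, P.levelSet_subset z hz hx⟩, hx, rfl⟩
  · rintro ⟨x, hx, rfl⟩
    exact hx

/-- Level sets are compact, so a nearest point exists and the Hausdorff bound loses nothing; `x₀`
only witnesses nonemptiness. -/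
theorem exists_near_of_mem_levelSet : ∃ L₀ : ℝ, 0 ≤ L₀ ∧ ∀ z' ∈ P.Z, ∀ z'' ∈ P.Z, ∀ x' x₀,
    P.F x' = z' → P.F x₀ = z'' → ∃ x'', P.F x'' = z'' ∧ dist x' x'' ≤ L₀ * ‖z' - z''‖ := by
  obtain ⟨L₀, h⟩ := P.levelSet_lipschitz
  refine ⟨|L₀|, abs_nonneg _, fun z' hz' z'' hz'' x' x₀ hx' hx₀ => ?_⟩
  obtain ⟨x'', hx'', he⟩ := (P.isCompact_levelSet hz'').exists_infEDist_eq_edist ⟨x₀, hx₀⟩ x'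
  refine ⟨x'', hx'', ?_⟩
  have h1 : edist x' x'' ≤ ENNReal.ofReal (|L₀| * ‖z' - z''‖) := by
    rw [← he]
    refine (Metric.infEDist_le_hausdorffEDist_of_mem (show x' ∈ P.F ⁻¹' {z'} from hx')).trans
      ((h z' hz' z'' hz'').trans (ENNReal.ofReal_le_ofReal ?_))
    gcongr
    exact le_abs_self _
  rw [edist_dist] at h1
  exact (ENNReal.ofReal_le_ofReal_iff (by positivity)).1 h1

/-- The integrand of the averaged field is continuous and Lipschitz in the state. -/
theorem continuous_fieldIntegrand :
    Continuous fun q : P.U × P.Y => fderiv ℝ P.F q.2 (P.g q.1 q.2) := by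
  obtain ⟨O, _, hYO, _, K, hK⟩ := P.smooth_F
  have h1 : Continuous fun x : P.Y => fderiv ℝ P.F x :=
    continuousOn_iff_continuous_domRestrict.1 (hK.continuousOn.mono hYO)
  exact (h1.comp continuous_snd).clm_apply (P.continuous_g.comp
    (continuous_fst.prodMk (continuous_subtype_val.comp continuous_snd)))

theorem continuous_costIntegrand : Continuous fun q : P.U × P.Y => P.r q.1 q.2 :=
  P.continuous_r.comp (continuous_fst.prodMk (continuous_subtype_val.comp continuous_snd))

theorem exists_fieldIntegrand_lipschitz : ∃ L : ℝ, 0 ≤ L ∧ ∀ (u : P.U) (x x' : P.Y),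
    ‖fderiv ℝ P.F x (P.g u x) - fderiv ℝ P.F x' (P.g u x')‖ ≤ L * dist x x' := by
  obtain ⟨O, _, hYO, _, K, hK⟩ := P.smooth_F
  obtain ⟨Kg, hKg⟩ := P.lipschitz_g
  have h1 : Continuous fun x : P.Y => fderiv ℝ P.F x :=
    continuousOn_iff_continuous_domRestrict.1 (hK.continuousOn.mono hYO)
  obtain ⟨C, hC⟩ := (isCompact_range h1).isBounded.exists_norm_le
  have h2 : Continuous fun q : P.U × P.Y => P.g q.1 q.2 :=
    P.continuous_g.comp (continuous_fst.prodMk (continuous_subtype_val.comp continuous_snd))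
  obtain ⟨B, hB⟩ := (isCompact_range h2).isBounded.exists_norm_le
  refine ⟨|C| * Kg + K * |B|, by positivity, fun u x x' => ?_⟩
  have hCx : ‖fderiv ℝ P.F x‖ ≤ |C| := (hC _ (mem_range_self x)).trans (le_abs_self _)
  have hBx : ‖P.g u x'‖ ≤ |B| := (hB _ (mem_range_self (u, x'))).trans (le_abs_self _)
  have e : fderiv ℝ P.F x (P.g u x) - fderiv ℝ P.F x' (P.g u x') =
      fderiv ℝ P.F x (P.g u x - P.g u x') + (fderiv ℝ P.F x - fderiv ℝ P.F x') (P.g u x') := by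
    rw [map_sub, sub_apply]
    abel
  rw [e]
  refine (norm_add_le _ _).trans ?_
  rw [add_mul]
  refine add_le_add ?_ ?_
  · refine (ContinuousLinearMap.le_opNorm _ _).trans ?_
    rw [mul_assoc]
    gcongr
    rw [← dist_eq_norm]
    exact (hKg u).dist_le_mul _ _
  · refine (ContinuousLinearMap.le_opNorm _ _).trans ?_
    rw [mul_right_comm]
    gcongr
    rw [← dist_eq_norm]
    exact hK.dist_le_mul _ (hYO x.2) _ (hYO x'.2)

variable {P}

namespace IsPeriodicOrbitFamily

variable {f : Vec m → Vec m} {T : P.Z → ℝ} {y : P.Z → ℝ → P.Y}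

theorem exists_lipschitzWith (hf : ∃ K, LipschitzWith K f)
    (hy : P.IsPeriodicOrbitFamily f T y) : ∃ M, ∀ z, LipschitzWith M (y z) := by
  have hfc : Continuous fun x : P.Y => f x :=
    hf.choose_spec.continuous.comp continuous_subtype_val
  obtain ⟨M, hM⟩ := (isCompact_range hfc).isBounded.exists_norm_le
  refine ⟨M.toNNReal, fun z => ?_⟩
  have h : LipschitzWith M.toNNReal fun t => (y z t : Vec m) := by
    refine lipschitzWith_of_nnnorm_deriv_le (𝕜 := ℝ)
      (fun t => (hy.hasDerivAt z t).differentiableAt) fun t => ?_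
    rw [(hy.hasDerivAt z t).deriv, ← NNReal.coe_le_coe, coe_nnnorm]
    exact (hM _ (mem_range_self (y z t))).trans (Real.le_coe_toNNReal M)
  exact h

theorem map_unit_eq_occupationalMeasure (hy : P.IsPeriodicOrbitFamily f T y) (z : P.Z) (θ : ℝ) :
    (volume.restrict (Icc (0 : ℝ) 1)).map (fun s => y z (T z * s + θ)) =
      occupationalMeasure (y z) (T z) := by
  have hm : Measurable fun t => y z (t + θ) :=
    ((hy.continuous z).comp (continuous_add_const θ)).measurable
  have hp := hy.isProbabilityMeasure z
  have hp' := isProbabilityMeasure_occupationalMeasure hm (hy.period_pos z)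
  rw [← occupationalMeasure_eq_map hm (hy.period_pos z)]
  suffices h : (⟨_, hp'⟩ : ProbabilityMeasure P.Y) = ⟨_, hp⟩ from congrArg Subtype.val h
  refine ProbabilityMeasure.eq_of_forall_lipschitz_integral_eq fun q ⟨L, hq⟩ => ?_
  simp only [ProbabilityMeasure.coe_mk]
  rw [integral_occupationalMeasure hm (hy.period_pos z) hq.continuous.stronglyMeasurable,
    hy.integral_shift z θ hq.continuous.stronglyMeasurable, smul_smul,
    inv_mul_cancel₀ (hy.period_pos z).ne', one_smul]

/-- Every `μ' ∈ W(z')` can be transported to some `μ'' ∈ W(z'')` along the orbits by a distance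
proportional to `‖z' - z''‖`. -/
theorem exists_transport (hf : ∀ u y, P.f u y = f y) (hy : P.IsPeriodicOrbitFamily f T y)
    (hT : ∃ L : ℝ, ∀ z' z'' : P.Z,
      |T z' - T z''| / max (T z') (T z'') ≤ L * ‖(z' : Vec k) - (z'' : Vec k)‖) :
    ∃ C : ℝ, 0 ≤ C ∧ ∀ z' z'' : P.Z, ∀ μ' ∈ P.W z', ∃ μ'' ∈ P.W z'',
      ∀ {G : Type} [NormedAddCommGroup G] [NormedSpace ℝ G] [SecondCountableTopology G]
        (q : P.U × P.Y → G) (L : ℝ), 0 ≤ L → Continuous q →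
        (∀ u x x', ‖q (u, x) - q (u, x')‖ ≤ L * dist x x') →
        ‖∫ ω, q ω ∂(μ' : Measure (P.U × P.Y)) - ∫ ω, q ω ∂(μ'' : Measure (P.U × P.Y))‖ ≤
          L * (C * ‖(z' : Vec k) - (z'' : Vec k)‖) := by
  have hfL := exists_lipschitzWith_of_forall_eq hf
  obtain ⟨K, hK⟩ := hfL
  obtain ⟨M, hM⟩ := hy.exists_lipschitzWith ⟨K, hK⟩
  obtain ⟨L₀, hL₀, hnear⟩ := P.exists_near_of_mem_levelSet
  obtain ⟨T₀, hT₀⟩ := hy.period_bounded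
  obtain ⟨L₁, hL₁⟩ := hT
  -- The first summand is Gronwall's bound over a time at most `T₀`, from starting points `L₀ * ‖z'
  -- - z''‖` apart. The second is the speed bound `M` times the bound for the difference of the
  -- periods.
  refine ⟨L₀ * Real.exp (K * T₀) + M * (|L₁| * |T₀|), by positivity, fun z' z'' μ' hμ' => ?_⟩
  have hν := hy.isProbabilityMeasure z'
  have hTd : |T z' - T z''| ≤ |L₁| * |T₀| * ‖(z' : Vec k) - z''‖ := by
    have hmax : 0 < max (T z') (T z'') := lt_max_of_lt_left (hy.period_pos z')
    have h1 := (div_le_iff₀ hmax).1 (hL₁ z' z'')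
    calc _ ≤ L₁ * ‖(z' : Vec k) - z''‖ * max (T z') (T z'') := h1
      _ ≤ |L₁| * ‖(z' : Vec k) - z''‖ * |T₀| := by
        gcongr
        · exact le_abs_self _
        · exact (max_le (hT₀ _) (hT₀ _)).trans (le_abs_self _)
      _ = _ := by ring
  obtain ⟨x'', hx'', hd⟩ := hnear z' z'.2 z'' z''.2 (y z' 0) (y z'' 0)
    (hy.mem_levelSet z' 0) (hy.mem_levelSet z'' 0)
  -- The phase `θ` starts the second orbit at the point nearest to the start of the first.
  obtain ⟨θ, rfl⟩ := hy.exists_time ⟨K, hK⟩ z'' hx''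
  have hdist : ∀ s ∈ Icc (0 : ℝ) 1, dist (y z' (T z' * s)) (y z'' (T z'' * s + θ)) ≤
      (L₀ * Real.exp (K * T₀) + M * (|L₁| * |T₀|)) * ‖(z' : Vec k) - z''‖ := by
    intro s hs
    have hts : 0 ≤ T z' * s := mul_nonneg (hy.period_pos z').le hs.1
    have hts' : T z' * s ≤ T₀ :=
      (mul_le_of_le_one_right (hy.period_pos z').le hs.2).trans (hT₀ z')
    have h1 : dist (y z' (T z' * s)) (y z'' (T z' * s + θ)) ≤
        L₀ * ‖(z' : Vec k) - z''‖ * Real.exp (K * T₀) := by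
      have h2 := IsSolution.dist_le hK (hy.isSolution z') (hy.isSolution_shift z'' θ) hts
      rw [zero_add] at h2
      refine h2.trans ?_
      gcongr
    have h3 : dist (y z'' (T z' * s + θ)) (y z'' (T z'' * s + θ)) ≤
        M * (|L₁| * |T₀| * ‖(z' : Vec k) - z''‖) := by
      refine ((hM z'').dist_le_mul _ _).trans ?_
      gcongr
      rw [dist_add_right, Real.dist_eq, ← sub_mul, abs_mul, abs_of_nonneg hs.1]
      exact (mul_le_of_le_one_right (abs_nonneg _) hs.2).trans hTd
    calc _ ≤ _ := dist_triangle _ (y z'' (T z' * s + θ)) _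
      _ ≤ _ := add_le_add h1 h3
      _ = _ := by ring
  obtain ⟨σ, hσ, hμσ⟩ : (μ' : ProbabilityMeasure _) ∈
      P.disintegrated (occupationalMeasure (y z') (T z')) := hy.W_eq_disintegrated hf z' ▸ hμ'
  set vol : Measure ℝ := volume.restrict (Icc (0 : ℝ) 1) with hvol
  have hvolp : IsProbabilityMeasure vol := ⟨by simp [hvol]⟩
  have hm' : Measurable fun s => y z' (T z' * s) :=
    ((hy.continuous z').comp (continuous_const_mul (T z'))).measurable
  have hm'' : Measurable fun s => y z'' (T z'' * s + θ) :=
    ((hy.continuous z'').comp (by fun_prop)).measurable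
  -- The coupling: `s` is uniform on `[0,1]` and `u` is drawn from `σ` at the first orbit's point.
  -- Both measures are images of `π` with the same `u`, so only the state moves.
  set π : Measure (ℝ × P.U) := vol ⊗ₘ (σ.comap _ hm') with hπ
  have ha : Measurable fun ω : ℝ × P.U => (ω.2, y z' (T z' * ω.1)) :=
    measurable_snd.prodMk (hm'.comp measurable_fst)
  have hb : Measurable fun ω : ℝ × P.U => (ω.2, y z'' (T z'' * ω.1 + θ)) :=
    measurable_snd.prodMk (hm''.comp measurable_fst)
  have hμa : (μ' : Measure (P.U × P.Y)) = π.map fun ω => (ω.2, y z' (T z' * ω.1)) := by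
    rw [hμσ, occupationalMeasure_eq_map (hy.continuous z').measurable (hy.period_pos z'),
      Measure.compProd_map_left vol hm' σ,
      Measure.map_map measurable_swap (hm'.prodMap measurable_id)]
    rfl
  have hμbp : IsProbabilityMeasure (π.map fun ω => (ω.2, y z'' (T z'' * ω.1 + θ))) :=
    Measure.isProbabilityMeasure_map hb.aemeasurable
  have hfst : π.map Prod.fst = vol := Measure.fst_compProd vol _
  refine ⟨(⟨_, hμbp⟩ : ProbabilityMeasure (P.U × P.Y)), (hy.mem_W_iff hf z'' _).2 ?_, ?_⟩
  · rw [ProbabilityMeasure.coe_mk, Measure.map_map measurable_snd hb,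
      ← hy.map_unit_eq_occupationalMeasure z'' θ, ← hvol, ← hfst, Measure.map_map hm'' measurable_fst]
    rfl
  · intro G _ _ _ q L hL hq hqL
    have hia : Integrable (fun ω : ℝ × P.U => q (ω.2, y z' (T z' * ω.1))) π :=
      (integrable_map_measure hq.aestronglyMeasurable ha.aemeasurable).1
        (hμa ▸ hq.integrable_of_compactSpace _)
    have hib : Integrable (fun ω : ℝ × P.U => q (ω.2, y z'' (T z'' * ω.1 + θ))) π :=
      (integrable_map_measure hq.aestronglyMeasurable hb.aemeasurable).1
        (hq.integrable_of_compactSpace _)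
    rw [ProbabilityMeasure.coe_mk, hμa, integral_map ha.aemeasurable hq.aestronglyMeasurable,
      integral_map hb.aemeasurable hq.aestronglyMeasurable, ← integral_sub hia hib]
    refine (norm_integral_le_of_norm_le_const (C := L * ((L₀ * Real.exp (K * T₀) +
      M * (|L₁| * |T₀|)) * ‖(z' : Vec k) - z''‖)) ?_).trans_eq (by simp)
    have hae : ∀ᵐ ω ∂π, ω.1 ∈ Icc (0 : ℝ) 1 := by
      refine ae_of_ae_map measurable_fst.aemeasurable (p := fun s : ℝ => s ∈ Icc (0 : ℝ) 1) ?_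
      rw [hfst]
      exact ae_restrict_mem measurableSet_Icc
    filter_upwards [hae] with ω hω
    exact (hqL _ _ _).trans (mul_le_mul_of_nonneg_left (hdist _ hω) hL)

theorem averagedMapsRegular (hf : ∀ u y, P.f u y = f y) (hy : P.IsPeriodicOrbitFamily f T y)
    {ρ : MetricSpace (ProbabilityMeasure (P.U × P.Y))} (hρ : IsWeakStarMetric ρ)
    (hT : ∃ L : ℝ, ∀ z' z'' : P.Z,
      |T z' - T z''| / max (T z') (T z'') ≤ L * ‖(z' : Vec k) - (z'' : Vec k)‖) :
    P.AveragedMapsRegular ρ := by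
  obtain ⟨C, hC, htr⟩ := hy.exists_transport hf hT
  choose tr htrW htrL using htr
  constructor
  -- With the measure as part of the index, the limit as `‖z' - z''‖ → 0` is uniform over `W`, as
  -- the Hausdorff distance requires.
  · let ι := {i : (P.Z × P.Z) × ProbabilityMeasure (P.U × P.Y) // i.2 ∈ P.W i.1.1}
    have hlim : Tendsto (fun i : ι => ρ.dist i.1.2 (tr i.1.1.1 i.1.1.2 i.1.2 i.2))
        (comap (fun i : ι => ‖(i.1.1.1 : Vec k) - i.1.1.2‖) (𝓝 0)) (𝓝 0) := by
      refine hρ.tendsto_dist fun q ⟨L, hq⟩ => ?_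
      have h1 : Tendsto (fun i : ι => (L : ℝ) * (C * ‖(i.1.1.1 : Vec k) - i.1.1.2‖))
          (comap (fun i : ι => ‖(i.1.1.1 : Vec k) - i.1.1.2‖) (𝓝 0)) (𝓝 0) := by
        have h0 : Tendsto (fun i : ι => ‖(i.1.1.1 : Vec k) - i.1.1.2‖)
            (comap (fun i : ι => ‖(i.1.1.1 : Vec k) - i.1.1.2‖) (𝓝 0)) (𝓝 0) := tendsto_comap
        simpa using (h0.const_mul C).const_mul (L : ℝ)
      refine squeeze_zero_norm (fun i => ?_) h1
      refine htrL _ _ _ i.2 q L L.2 hq.continuous fun u x x' => ?_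
      rw [← dist_eq_norm]
      refine (hq.dist_le_mul _ _).trans_eq ?_
      rw [dist_prod_same_left]
    intro z hz
    rw [ENNReal.tendsto_nhds_zero]
    intro ε hε
    obtain ⟨ε', hε', hεε⟩ : ∃ ε' : ℝ, 0 < ε' ∧ ENNReal.ofReal ε' ≤ ε := by
      obtain ⟨r, hr0, hr⟩ := ENNReal.lt_iff_exists_real_btwn.1 hε
      exact ⟨r, ENNReal.ofReal_pos.1 hr.1, hr.2.le⟩
    have hev := hlim.eventually (gt_mem_nhds hε')
    rw [eventually_comap, Metric.eventually_nhds_iff] at hev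
    obtain ⟨δ, hδ, hev⟩ := hev
    have key : ∀ z' z'' : P.Z, ‖(z' : Vec k) - z''‖ < δ → ∀ μ (hμ : μ ∈ P.W z'),
        @edist _ ρ.toPseudoMetricSpace.toPseudoEMetricSpace.toEDist μ (tr z' z'' μ hμ) ≤ ε := by
      intro z' z'' hz μ hμ
      have h1 := hev (y := ‖(z' : Vec k) - z''‖) (by simpa using hz) ⟨((z', z''), μ), hμ⟩ rfl
      rw [@edist_dist _ ρ.toPseudoMetricSpace]
      exact (ENNReal.ofReal_le_ofReal h1.le).trans hεε
    filter_upwards [self_mem_nhdsWithin, mem_nhdsWithin_of_mem_nhds (Metric.ball_mem_nhds z hδ)]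
      with z' hz' hb
    rw [mem_ball_iff_norm] at hb
    refine @Metric.hausdorffEDist_le_of_mem_edist _
      ρ.toPseudoMetricSpace.toPseudoEMetricSpace _ _ _ ?_ ?_
    · intro μ hμ
      exact ⟨_, htrW ⟨z', hz'⟩ ⟨z, hz⟩ μ hμ, key ⟨z', hz'⟩ ⟨z, hz⟩ hb μ hμ⟩
    · intro μ hμ
      exact ⟨_, htrW ⟨z, hz⟩ ⟨z', hz'⟩ μ hμ,
        key ⟨z, hz⟩ ⟨z', hz'⟩ (by rwa [norm_sub_rev]) μ hμ⟩
  · obtain ⟨Lf, hLf0, hLf⟩ := P.exists_fieldIntegrand_lipschitz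
    obtain ⟨Lr, hLr⟩ := P.lipschitz_r
    have key : ∀ z' z'' : P.Z, ∀ v ∈ P.V z', ∃ v' ∈ P.V z'',
        edist v v' ≤ ENNReal.ofReal ((Lf + Lr) * C * ‖(z' : Vec k) - z''‖) := by
      rintro z' z'' _ ⟨μ, hμ, rfl⟩
      refine ⟨_, ⟨_, htrW z' z'' μ hμ, rfl⟩, ?_⟩
      rw [edist_dist]
      refine ENNReal.ofReal_le_ofReal ((WithLp.dist_prod_two_le _ _).trans ?_)
      have h1 := htrL z' z'' μ hμ _ Lf hLf0 P.continuous_fieldIntegrand hLf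
      have h2 := htrL z' z'' μ hμ _ Lr Lr.2 P.continuous_costIntegrand (fun u x x' => by
        rw [← dist_eq_norm]; exact (hLr u).dist_le_mul x x')
      rw [← dist_eq_norm] at h1 h2
      calc _ ≤ _ := add_le_add h1 h2
        _ = _ := by ring
    refine ⟨(Lf + Lr) * C, fun z' hz' z'' hz'' => ?_⟩
    refine Metric.hausdorffEDist_le_of_mem_edist (key ⟨z', hz'⟩ ⟨z'', hz''⟩) ?_
    rw [norm_sub_rev]
    exact key ⟨z'', hz''⟩ ⟨z', hz'⟩

end IsPeriodicOrbitFamily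

end SlowObservableSystem

/-! ### Long-time averages of periodic functions. -/

theorem Measurable.intervalIntegrable_of_abs_le {g : ℝ → ℝ} {C : ℝ} (hg : Measurable g)
    (hC : ∀ t, |g t| ≤ C) (a b : ℝ) : IntervalIntegrable g volume a b := by
  rw [_root_.intervalIntegrable_iff]
  exact Measure.integrableOn_of_bounded (M := C) (by simp) hg.aestronglyMeasurable
    (ae_of_all _ hC)

theorem MeasureTheory.abs_integral_le_of_abs_le {X : Type*} [MeasurableSpace X] (μ : Measure X)
    [IsProbabilityMeasure μ] {g : X → ℝ} {C : ℝ} (hC : ∀ x, |g x| ≤ C) : |∫ x, g x ∂μ| ≤ C := by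
  simpa using norm_integral_le_of_norm_le_const (μ := μ) (f := g) (C := C) (ae_of_all _ hC)

/-- Whole periods contribute exactly their mean. The incomplete last period and its share of the
mean cost at most `C * T` each. -/
theorem Function.Periodic.abs_integral_sub_le {g : ℝ → ℝ} {T C : ℝ} (hg : Function.Periodic g T)
    (hT : 0 < T) (hm : Measurable g) (hC : ∀ t, |g t| ≤ C) {S : ℝ} (hS : 0 ≤ S) :
    |(∫ t in (0 : ℝ)..S, g t) - S * (T⁻¹ * ∫ t in (0 : ℝ)..T, g t)| ≤ 2 * C * T := by
  have hC0 : 0 ≤ C := (abs_nonneg _).trans (hC 0)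
  have hint : ∀ a b, IntervalIntegrable g volume a b := 
    hm.intervalIntegrable_of_abs_le hC
  have hbd : ∀ a b, |∫ t in a..b, g t| ≤ C * |b - a| := fun a b => by
    rw [← Real.norm_eq_abs]
    exact intervalIntegral.norm_integral_le_of_norm_le_const fun t _ => hC t
  set n : ℕ := ⌊S / T⌋₊ with hn
  have h1 : (n : ℝ) * T ≤ S := (le_div_iff₀ hT).1 (Nat.floor_le (by positivity))
  have h2 : S < (n + 1) * T := (div_lt_iff₀ hT).1 (Nat.lt_floor_add_one _)
  have h3 : ∫ t in (0 : ℝ)..n * T, g t = n * ∫ t in (0 : ℝ)..T, g t := by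
    have := hg.intervalIntegral_add_zsmul_eq n 0 hint
    simpa using this
  rw [← intervalIntegral.integral_add_adjacent_intervals (hint 0 (n * T)) (hint _ S), h3]
  have e : (n * ∫ t in (0 : ℝ)..T, g t) + (∫ t in (n * T)..S, g t) -
      S * (T⁻¹ * ∫ t in (0 : ℝ)..T, g t) =
      (∫ t in (n * T)..S, g t) - (S - n * T) * (T⁻¹ * ∫ t in (0 : ℝ)..T, g t) := by
    field_simp
    ring
  rw [e]
  refine (abs_sub _ _).trans ?_
  have h4 : |S - n * T| ≤ T := by rw [abs_of_nonneg (by linarith)]; linarith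
  have h5 : |T⁻¹ * ∫ t in (0 : ℝ)..T, g t| ≤ C := by
    rw [abs_mul, abs_of_pos (inv_pos.2 hT), inv_mul_le_iff₀ hT]
    refine (hbd 0 T).trans_eq ?_
    rw [sub_zero, abs_of_pos hT, mul_comm]
  have h6 := hbd (n * T) S
  rw [abs_mul]
  have h7 : C * |S - n * T| ≤ C * T := by gcongr
  have h8 : |S - n * T| * |T⁻¹ * ∫ t in (0 : ℝ)..T, g t| ≤ T * C := by gcongr
  linarith

/-! ### Chattering: replacing relaxed controls by ordinary ones. -/

section Chattering

variable {U : Type*} [MeasurableSpace U] [StandardBorelSpace U] [Nonempty U]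

theorem exists_measurable_map_volume_Icc_eq (μ : Measure U) [IsProbabilityMeasure μ] :
    ∃ G : ℝ → U, Measurable G ∧ (volume.restrict (Icc (0 : ℝ) 1)).map G = μ := by
  obtain ⟨G, hG, hGμ⟩ := μ.exists_measurable_map_eq
  have hp : Measurable (projIcc (0 : ℝ) 1 zero_le_one) := continuous_projIcc.measurable
  refine ⟨G ∘ projIcc 0 1 zero_le_one, hG.comp hp, ?_⟩
  rw [← Measure.map_map hG hp, ← unitInterval.measurePreserving_coe.map_eq,
    Measure.map_map hp measurable_subtype_coe]
  have : projIcc (0 : ℝ) 1 zero_le_one ∘ (Subtype.val : Icc (0 : ℝ) 1 → ℝ) = id := by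
    funext s
    exact projIcc_val zero_le_one s
  rw [this, Measure.map_id, hGμ]

/-- A relaxed control can be replaced by an ordinary one with the same averages on the unit
intervals. -/
theorem ProbabilityTheory.Kernel.exists_measurable_integral_unit_eq (κ : Kernel ℝ U)
    [IsMarkovKernel κ] :
    ∃ u : ℝ → U, Measurable u ∧ ∀ (j : ℕ) (g : U → ℝ) (C : ℝ), Measurable g → (∀ v, |g v| ≤ C) →
      ∫ t in (j : ℝ)..j + 1, g (u t) = ∫ t in (j : ℝ)..j + 1, ∫ v, g v ∂κ t := by
  set vol : Measure ℝ := volume.restrict (Icc (0 : ℝ) 1) with hvol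
  have hvolp : IsProbabilityMeasure vol := ⟨by simp [hvol]⟩
  have hadd : ∀ j : ℕ, Measurable fun s : ℝ => s + j := fun j => measurable_add_const _
  have hp : ∀ j : ℕ, IsProbabilityMeasure
      ((vol ⊗ₘ (κ.comap (fun s : ℝ => s + j) (hadd j))).map Prod.snd) := fun j =>
    Measure.isProbabilityMeasure_map measurable_snd.aemeasurable
  -- The measure realized by `G j` is the average of `κ t` over `[j, j + 1]`; the control runs
  -- through `G j` during that interval.
  choose G hG hGμ using fun j : ℕ => exists_measurable_map_volume_Icc_eq
    ((vol ⊗ₘ (κ.comap (fun s : ℝ => s + j) (hadd j))).map Prod.snd)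
  have hGm : Measurable fun q : ℝ × ℕ => G q.2 q.1 :=
    measurable_from_prod_countable_left fun j => hG j
  refine ⟨fun t => G ⌊t⌋₊ (t - ⌊t⌋₊), ?_, ?_⟩
  · have hfl : Measurable fun t : ℝ => ⌊t⌋₊ := Nat.measurable_floor
    have h : Measurable fun t : ℝ => (t - (⌊t⌋₊ : ℝ), ⌊t⌋₊) :=
      (measurable_id.sub (measurable_from_nat.comp hfl)).prodMk hfl
    exact hGm.comp h
  · intro j g C hg hC
    have hcv : ∀ w : ℝ → ℝ, ∫ t in (j : ℝ)..j + 1, w t = ∫ s in (0 : ℝ)..1, w (s + j) := by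
      intro w
      rw [intervalIntegral.integral_comp_add_right, zero_add, add_comm]
    have hvi : ∀ w : ℝ → ℝ, ∫ s in (0 : ℝ)..1, w s = ∫ s, w s ∂vol := by
      intro w
      rw [intervalIntegral.integral_of_le zero_le_one, hvol, integral_Icc_eq_integral_Ioc]
    have h1 : ∫ t in (j : ℝ)..j + 1, g (G ⌊t⌋₊ (t - ⌊t⌋₊)) = ∫ s, g (G j s) ∂vol := by
      rw [hcv, ← hvi]
      refine intervalIntegral.integral_congr_Ioo_of_le zero_le_one fun s hs => ?_
      have hfl : ⌊s + (j : ℝ)⌋₊ = j := by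
        rw [Nat.floor_eq_iff (by linarith [hs.1, (Nat.cast_nonneg j : (0 : ℝ) ≤ j)])]
        exact ⟨by linarith [hs.1], by linarith [hs.2]⟩
      simp only [hfl, add_sub_cancel_right]
    have hint : Integrable (fun ω : ℝ × U => g ω.2)
        (vol ⊗ₘ (κ.comap (fun s : ℝ => s + j) (hadd j))) :=
      Integrable.of_bound (hg.comp measurable_snd).aestronglyMeasurable C
        (ae_of_all _ fun ω => hC ω.2)
    rw [h1, ← integral_map (hG j).aemeasurable hg.aestronglyMeasurable, hGμ j,
      integral_map measurable_snd.aemeasurable hg.aestronglyMeasurable,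
      Measure.integral_compProd hint, hcv, hvi]
    rfl

variable {Y : Type*} [PseudoMetricSpace Y] [MeasurableSpace Y]

/-- Averages match exactly only for functions of the control alone. Freezing the state at the left
end of each unit interval costs `L * M` in each of the two integrals. -/
theorem ProbabilityTheory.Kernel.exists_measurable_abs_integral_sub_le (κ : Kernel ℝ U)
    [IsMarkovKernel κ] {y : ℝ → Y} {M : ℝ} (hM : 0 ≤ M) (hym : Measurable y)
    (hy : ∀ s t, dist (y s) (y t) ≤ M * |s - t|) :
    ∃ u : ℝ → U, Measurable u ∧ ∀ (q : U × Y → ℝ) (L C : ℝ), Measurable q → 0 ≤ L →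
      (∀ ω, |q ω| ≤ C) → (∀ v x x', |q (v, x) - q (v, x')| ≤ L * dist x x') → ∀ N : ℕ,
      |(∫ t in (0 : ℝ)..N, q (u t, y t)) - ∫ t in (0 : ℝ)..N, ∫ v, q (v, y t) ∂κ t| ≤
        2 * L * M * N := by
  obtain ⟨u, hu, hueq⟩ := κ.exists_measurable_integral_unit_eq
  refine ⟨u, hu, fun q L C hq hL hC hqL N => ?_⟩
  have hbi : ∀ w : ℝ → ℝ, StronglyMeasurable w → (∀ t, |w t| ≤ C) → ∀ a b,
      IntervalIntegrable w volume a b := fun w hw hwC =>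
    hw.measurable.intervalIntegrable_of_abs_le hwC
  have hqv : ∀ x, Measurable fun v => q (v, x) := fun x => hq.comp measurable_prodMk_right
  have hκC : ∀ t x, |∫ v, q (v, x) ∂κ t| ≤ C := fun t x =>
    abs_integral_le_of_abs_le _ fun v => hC (v, x)
  have hqi : ∀ t x, Integrable (fun v => q (v, x)) (κ t) := fun t x =>
    Integrable.of_bound (hqv x).aestronglyMeasurable C (ae_of_all _ fun v => hC (v, x))
  have hA : StronglyMeasurable fun t => q (u t, y t) :=
    (hq.comp (hu.prodMk hym)).stronglyMeasurable
  have hB : StronglyMeasurable fun t => ∫ v, q (v, y t) ∂κ t :=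
    StronglyMeasurable.integral_kernel_prod_right (f := fun t v => q (v, y t))
      (hq.comp (measurable_snd.prodMk (hym.comp measurable_fst))).stronglyMeasurable
  have hAx : ∀ x, StronglyMeasurable fun t => q (u t, x) := fun x =>
    ((hqv x).comp hu).stronglyMeasurable
  have hBx : ∀ x, StronglyMeasurable fun t => ∫ v, q (v, x) ∂κ t := fun x =>
    StronglyMeasurable.integral_kernel (hqv x).stronglyMeasurable
  have hAi := hbi _ hA fun t => hC _
  have hBi := hbi _ hB fun t => hκC _ _
  have hAxi := fun x => hbi _ (hAx x) fun t => hC _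
  have hBxi := fun x => hbi _ (hBx x) fun t => hκC _ _
  have hstep : ∀ j : ℕ, |(∫ t in (j : ℝ)..j + 1, q (u t, y t)) -
      ∫ t in (j : ℝ)..j + 1, ∫ v, q (v, y t) ∂κ t| ≤ 2 * L * M := by
    intro j
    have hyj : ∀ t ∈ uIoc (j : ℝ) (j + 1), L * dist (y t) (y j) ≤ L * M := by
      intro t ht
      rw [uIoc_of_le (by linarith)] at ht
      gcongr
      refine (hy t j).trans (mul_le_of_le_one_right hM ?_)
      rw [abs_of_nonneg (by linarith [ht.1])]
      linarith [ht.2]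
    have h1 : |∫ t in (j : ℝ)..j + 1, (q (u t, y t) - q (u t, y j))| ≤ L * M := by
      have := intervalIntegral.norm_integral_le_of_norm_le_const (C := L * M)
        (f := fun t => q (u t, y t) - q (u t, y j)) (a := (j : ℝ)) (b := j + 1)
        fun t ht => (hqL _ _ _).trans (hyj t ht)
      simpa using this
    have h2 : |∫ t in (j : ℝ)..j + 1, ((∫ v, q (v, y t) ∂κ t) - ∫ v, q (v, y j) ∂κ t)| ≤
        L * M := by
      have := intervalIntegral.norm_integral_le_of_norm_le_const (C := L * M)
        (f := fun t => (∫ v, q (v, y t) ∂κ t) - ∫ v, q (v, y j) ∂κ t) (a := (j : ℝ)) (b := j + 1)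
        fun t ht => by
          rw [← integral_sub (hqi _ _) (hqi _ _)]
          exact abs_integral_le_of_abs_le _ fun v => (hqL _ _ _).trans (hyj t ht)
      simpa using this
    rw [intervalIntegral.integral_sub (hAi _ _) (hAxi _ _ _)] at h1
    rw [intervalIntegral.integral_sub (hBi _ _) (hBxi _ _ _)] at h2
    have h3 := hueq j (fun v => q (v, y j)) C (hqv _) fun v => hC _
    rw [abs_le] at h1 h2 ⊢
    constructor <;> linarith [h1.1, h1.2, h2.1, h2.2]
  have hsum : ∀ w : ℝ → ℝ, (∀ a b, IntervalIntegrable w volume a b) →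
      ∫ t in (0 : ℝ)..N, w t = ∑ j ∈ Finset.range N, ∫ t in (j : ℝ)..j + 1, w t := by
    intro w hw
    have := intervalIntegral.sum_integral_adjacent_intervals (μ := volume) (f := w)
      (a := fun j : ℕ => (j : ℝ)) (n := N) fun j _ => hw _ _
    simpa using this.symm
  rw [hsum _ hAi, hsum _ hBi, ← Finset.sum_sub_distrib]
  refine (Finset.abs_sum_le_sum_abs _ _).trans ((Finset.sum_le_sum fun j _ => hstep j).trans_eq ?_)
  simp [mul_comm]

end Chattering

/-! ### Uniform approximation of `W` by occupational measures. -/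

namespace SlowObservableSystem.IsPeriodicOrbitFamily

variable {p m k : ℕ} {P : SlowObservableSystem p m k}
  {f : Vec m → Vec m} {T : P.Z → ℝ} {y : P.Z → ℝ → P.Y}

theorem isControlledSolution_shift (hf : ∀ u y, P.f u y = f y)
    (hy : P.IsPeriodicOrbitFamily f T y) (z : P.Z) (θ : ℝ) (u : ℝ → P.U) :
    P.IsControlledSolution u (fun t => (y z (t + θ) : Vec m)) := by
  have hfc : Continuous f := (exists_lipschitzWith_of_forall_eq hf).choose_spec.continuous
  have hc : Continuous fun t => (y z (t + θ) : Vec m) :=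
    continuous_subtype_val.comp ((hy.continuous z).comp (continuous_add_const θ))
  refine ⟨hc.continuousOn, fun t _ => ?_⟩
  simp only [hf]
  rw [intervalIntegral.integral_eq_sub_of_hasDerivAt
    (fun s _ => (hy.hasDerivAt z (s + θ)).comp_add_const s θ)
    ((hfc.comp hc).intervalIntegrable _ _)]
  simp

/-- Every `μ ∈ W(z)` is approximated by an occupational measure on `[0,S]` with an error of order
`1/S` in the integrals of Lipschitz functions. -/
theorem exists_occupationalMeasure_near (hf : ∀ u y, P.f u y = f y)
    (hy : P.IsPeriodicOrbitFamily f T y) :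
    ∃ A B : ℝ, ∀ S, 0 < S → ∀ (z : P.Z) (y₀ : Vec m), P.F y₀ = z → ∀ μ ∈ P.W z,
      ∃ γ ∈ P.occupationalMeasures S y₀, ∀ (q : P.U × P.Y → ℝ) (L C : ℝ), 0 ≤ L → Continuous q →
        (∀ ω, |q ω| ≤ C) → (∀ v x x', |q (v, x) - q (v, x')| ≤ L * dist x x') →
        |∫ ω, q ω ∂(μ : Measure (P.U × P.Y)) - ∫ ω, q ω ∂(γ : Measure (P.U × P.Y))| ≤
          (A * L + B * C) / S := by
  have hfL := exists_lipschitzWith_of_forall_eq hf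
  obtain ⟨M, hM⟩ := hy.exists_lipschitzWith hfL
  obtain ⟨T₀, hT₀⟩ := hy.period_bounded
  -- `2 * M` comes from chattering, `2 * T₀` from the incomplete last period.
  refine ⟨2 * M, 2 * T₀, fun S hS z y₀ hy₀ μ hμ => ?_⟩
  obtain ⟨θ, rfl⟩ := hy.exists_time hfL z hy₀
  obtain ⟨σ, hσ, hμσ⟩ : μ ∈ P.disintegrated (occupationalMeasure (y z) (T z)) :=
    hy.W_eq_disintegrated hf z ▸ hμ
  have hν := hy.isProbabilityMeasure z
  -- `[0,S]` is cut into `N` pieces of length `h ≤ 1 / S`. The chattering error of the integral over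
  -- `[0,S]` is at most `2 * M * L * (S * h)`, hence bounded in `S`.
  set N : ℕ := ⌈S ^ 2⌉₊ with hN_def
  have hNS : S ^ 2 ≤ N := Nat.le_ceil _
  have hN : (0 : ℝ) < N := lt_of_lt_of_le (by positivity) hNS
  set h : ℝ := S / N with hh_def
  have hh : 0 < h := div_pos hS hN
  have hhN : h * N = S := by rw [hh_def]; field_simp
  have hhS : h ≤ 1 / S := by
    rw [hh_def, div_le_div_iff₀ hN hS]
    nlinarith
  have hyθ : Measurable fun t => y z (t + θ) :=
    ((hy.continuous z).comp (continuous_add_const θ)).measurable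
  have hyh : Measurable fun t => y z (h * t + θ) :=
    ((hy.continuous z).comp (by fun_prop)).measurable
  -- Time is rescaled so that the pieces have unit length; the state then has Lipschitz constant `M
  -- * h`.
  obtain ⟨u, hu, hub⟩ := (σ.comap _ hyh).exists_measurable_abs_integral_sub_le
    (y := fun t => y z (h * t + θ)) (M := M * h) (by positivity) hyh (by
      intro s t
      refine ((hM z).dist_le_mul _ _).trans_eq ?_
      rw [dist_add_right, Real.dist_eq, ← mul_sub, abs_mul, abs_of_pos hh, mul_assoc])
  have hut : Measurable fun t => u (h⁻¹ * t) := hu.comp (measurable_const_mul _)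
  have hw : Measurable fun t => (u (h⁻¹ * t), y z (t + θ)) := hut.prodMk hyθ
  refine ⟨⟨_, isProbabilityMeasure_occupationalMeasure hw hS⟩,
    ⟨fun t => u (h⁻¹ * t), fun t => y z (t + θ), hut,
      hy.isControlledSolution_shift hf z θ _, by simp, rfl⟩, ?_⟩
  intro q L C hL hq hC hqL
  have hC0 : 0 ≤ C := by
    obtain ⟨v⟩ : Nonempty P.U := inferInstance
    exact (abs_nonneg _).trans (hC (v, y z 0))
  set Q : P.Y → ℝ := fun x => ∫ v, q (v, x) ∂σ x with hQ
  have hQm : StronglyMeasurable Q :=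
    StronglyMeasurable.integral_kernel_prod_right (f := fun x v => q (v, x))
      (hq.measurable.comp measurable_swap).stronglyMeasurable
  have hQC : ∀ x, |Q x| ≤ C := fun x => abs_integral_le_of_abs_le _ fun v => hC (v, x)
  have hscale : ∀ w : ℝ → ℝ, ∫ t in (0 : ℝ)..S, w t = h * ∫ t in (0 : ℝ)..N, w (h * t) := by
    intro w
    rw [intervalIntegral.integral_comp_mul_left w hh.ne', mul_zero, hhN, smul_eq_mul,
      mul_inv_cancel_left₀ hh.ne']
  have hμint : ∫ ω, q ω ∂(μ : Measure (P.U × P.Y)) =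
      (T z)⁻¹ * ∫ t in (0 : ℝ)..T z, Q (y z (t + θ)) := by
    have hi : Integrable (fun ω : P.Y × P.U => q ω.swap)
        (occupationalMeasure (y z) (T z) ⊗ₘ σ) :=
      (hq.comp continuous_swap).integrable_of_compactSpace _
    rw [hμσ, integral_map measurable_swap.aemeasurable hq.aestronglyMeasurable,
      Measure.integral_compProd hi, hy.integral_shift z θ hQm, smul_eq_mul,
      inv_mul_cancel_left₀ (hy.period_pos z).ne']
    rfl
  have hper : Function.Periodic (fun t => Q (y z (t + θ))) (T z) := by
    intro t
    have : y z (t + T z + θ) = y z (t + θ) := by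
      rw [add_right_comm]
      exact hy.periodic z _
    simp only [this]
  have h1 := hper.abs_integral_sub_le (hy.period_pos z) (hQm.measurable.comp hyθ)
    (fun t => hQC _) hS.le
  have h2 := hub q L C hq.measurable hL hC hqL N
  have hγint : ∫ t in (0 : ℝ)..S, q (u (h⁻¹ * t), y z (t + θ)) =
      h * ∫ t in (0 : ℝ)..N, q (u t, y z (h * t + θ)) := by
    rw [hscale]
    simp only [inv_mul_cancel_left₀ hh.ne']
  have hQint : ∫ t in (0 : ℝ)..S, Q (y z (t + θ)) =
      h * ∫ t in (0 : ℝ)..N, ∫ v, q (v, y z (h * t + θ)) ∂(σ.comap _ hyh t) := by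
    rw [hscale]
    rfl
  have h3 : |(∫ t in (0 : ℝ)..S, q (u (h⁻¹ * t), y z (t + θ))) -
      ∫ t in (0 : ℝ)..S, Q (y z (t + θ))| ≤ 2 * M * L := by
    rw [hγint, hQint, ← mul_sub, abs_mul, abs_of_pos hh]
    calc _ ≤ h * (2 * L * (M * h) * N) := by gcongr
      _ = 2 * M * L * (S * h) := by rw [← hhN]; ring
      _ ≤ 2 * M * L * 1 := by
        gcongr
        rwa [le_div_iff₀ hS, mul_comm] at hhS
      _ = _ := mul_one _
  rw [ProbabilityMeasure.coe_mk, integral_occupationalMeasure hw hS hq.stronglyMeasurable, hμint,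
    smul_eq_mul]
  have h4 : 2 * C * T z ≤ 2 * T₀ * C := by
    have := mul_le_mul_of_nonneg_left (hT₀ z) hC0
    linarith
  rw [le_div_iff₀ hS, ← abs_of_pos hS, ← abs_mul, abs_of_pos hS]
  have e : ((T z)⁻¹ * (∫ t in (0 : ℝ)..T z, Q (y z (t + θ))) -
      S⁻¹ * ∫ t in (0 : ℝ)..S, q (u (h⁻¹ * t), y z (t + θ))) * S =
      S * ((T z)⁻¹ * ∫ t in (0 : ℝ)..T z, Q (y z (t + θ))) -
        ∫ t in (0 : ℝ)..S, q (u (h⁻¹ * t), y z (t + θ)) := by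
    rw [sub_mul, mul_comm _ S, mul_comm _ S, mul_inv_cancel_left₀ hS.ne']
  rw [e]
  rw [abs_le] at h1 h3 ⊢
  constructor <;> linarith [h1.1, h1.2, h3.1, h3.2]

theorem uniformlyApproximable (hf : ∀ u y, P.f u y = f y) (hy : P.IsPeriodicOrbitFamily f T y)
    {ρ : MetricSpace (ProbabilityMeasure (P.U × P.Y))} (hρ : IsWeakStarMetric ρ) :
    P.UniformlyApproximable ρ := by
  obtain ⟨A, B, hAB⟩ := hy.exists_occupationalMeasure_near hf
  choose γ hγ hγq using hAB
  -- All data are part of the index and only `S` drives the filter, so the limit is uniform in `z`,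
  -- `y₀` and `μ`.
  let ι := {i : ℝ × P.Z × Vec m × ProbabilityMeasure (P.U × P.Y) //
    0 < i.1 ∧ P.F i.2.2.1 = i.2.1 ∧ i.2.2.2 ∈ P.W i.2.1}
  let d : ι → ℝ := fun i => ρ.dist i.1.2.2.2
    (γ i.1.1 i.2.1 i.1.2.1 i.1.2.2.1 i.2.2.1 i.1.2.2.2 i.2.2.2)
  have hd0 : ∀ i, 0 ≤ d i := fun i => @dist_nonneg _ ρ.toPseudoMetricSpace _ _
  have hlim : Tendsto d (comap (fun i : ι => i.1.1) atTop) (𝓝 0) := by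
    refine hρ.tendsto_dist fun q ⟨L, hq⟩ => ?_
    obtain ⟨C, hC⟩ := (isCompact_range hq.continuous).isBounded.exists_norm_le
    have h1 : Tendsto (fun i : ι => (A * L + B * C) / i.1.1)
        (comap (fun i : ι => i.1.1) atTop) (𝓝 0) :=
      tendsto_comap.const_div_atTop _
    refine squeeze_zero_norm (fun i => ?_) h1
    refine hγq _ _ _ _ _ _ _ q L C L.2 hq.continuous (fun ω => hC _ (mem_range_self ω))
      fun v x x' => ?_
    rw [← Real.dist_eq]
    refine (hq.dist_le_mul _ _).trans_eq ?_
    rw [dist_prod_same_left]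
  obtain ⟨D, hD⟩ := (isCompact_range hρ.continuous_dist).isBounded.exists_norm_le
  have hdD : ∀ i, d i ≤ D := fun i =>
    (le_abs_self _).trans (hD _ (mem_range_self (i.1.2.2.2, _)))
  -- The supremum is a genuine one because `ρ` is bounded on the compact space of measures; over an
  -- empty index set it is `0`.
  refine ⟨fun S => sSup (d '' {i | i.1.1 = S}), ?_, ?_⟩
  · rw [Metric.tendsto_nhds]
    intro ε hε
    have hev := hlim.eventually (gt_mem_nhds (half_pos hε))
    rw [eventually_comap] at hev
    filter_upwards [hev] with S hS
    have h1 : sSup (d '' {i | i.1.1 = S}) ≤ ε / 2 := by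
      refine Real.sSup_le ?_ (half_pos hε).le
      rintro _ ⟨i, hi, rfl⟩
      exact (hS i hi).le
    have h2 : 0 ≤ sSup (d '' {i | i.1.1 = S}) := by
      refine Real.sSup_nonneg ?_
      rintro _ ⟨i, _, rfl⟩
      exact hd0 i
    rw [Real.dist_eq, sub_zero, abs_of_nonneg h2]
    linarith
  · intro S hS z hz y₀ hy₀ μ hμ
    refine (@Metric.infEDist_le_edist_of_mem _ ρ.toPseudoMetricSpace.toPseudoEMetricSpace _ _ _
      (hγ S hS ⟨z, hz⟩ y₀ hy₀ μ hμ)).trans ?_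
    rw [@edist_dist _ ρ.toPseudoMetricSpace]
    refine ENNReal.ofReal_le_ofReal ?_
    refine le_csSup ⟨D, ?_⟩ ⟨⟨(S, ⟨z, hz⟩, y₀, μ), hS, hy₀, hμ⟩, rfl, rfl⟩
    rintro _ ⟨i, _, rfl⟩
    exact hdD i

end SlowObservableSystem.IsPeriodicOrbitFamily

theorem mainTheorem8 {p m k : ℕ} (P : SlowObservableSystem p m k)
    (f : Vec m → Vec m) (hf : ∀ u y, P.f u y = f y)
    (T : P.Z → ℝ) (y : P.Z → ℝ → P.Y) (hy : P.IsPeriodicOrbitFamily f T y)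
    (ρ : MetricSpace (ProbabilityMeasure (P.U × P.Y))) (hρ : IsWeakStarMetric ρ) :
    (∀ z : P.Z, P.W z = P.disintegrated (occupationalMeasure (y z) (T z))) ∧
    P.UniformlyApproximable ρ ∧
    ((∃ L : ℝ, ∀ z' z'' : P.Z,
        |T z' - T z''| / max (T z') (T z'') ≤ L * ‖(z' : Vec k) - (z'' : Vec k)‖) →
      P.AveragedMapsRegular ρ) := by
  exact ⟨hy.W_eq_disintegrated hf, hy.uniformlyApproximable hf hρ, hy.averagedMapsRegular hf hρ⟩
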